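/- Let $D$ be a digraph (finite or infinite, of any cardinality, without loops and without parallel edges) with vertex set $V$ and edge set $E$. For $X\subseteq V$ finite, the strong components of $D-X$ are its maximal strongly connected subdigraphs. A ray (one-way infinite directed path with a first vertex) is solid if for every finite $X\subseteq V$ it has a tail in some strong component of $D-X$; two solid rays are equivalent if for every finite $X\subseteq V$ they have tails in the same strong component of $D-X$. The ends of $D$ are the equivalence classes of solid rays; $\Omega$ is the set of ends, and $C(X,\omega)$ is the strong component of $D-X$ in which the rays of $\omega$ have a tail ("in which $\omega$ lives"). The limit edges of $D$ are: the pairs $(\omega,\eta)$ of distinct ends such that $D$ has an edge from $C(X,\omega)$ to $C(X,\eta)$ for every finite $X$ with $C(X,\omega)\ne C(X,\eta)$; and the pairs $(v,\omega)$ (respectively $(\omega,v)$) with $v\in V$, $\omega\in\Omega$ such that $D$ has an edge from $v$ to $C(X,\omega)$ (respectively from $C(X,\omega)$ to $v$) for every finite $X$ with $v\notin C(X,\omega)$. Let $\Lambda$ be the set of limit edges. The space $|D|$ is obtained from $V\cup\Omega$ by adding a copy $[0,1]_e$ of the unit interval for every $e\in E\cup\Lambda$, with $0$ identified with the tail and $1$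 with the head of $e$. Its topology is generated by the following basic open sets, where $0<\varepsilon\le 1$ and $X\subseteq V$ is finite. We say that $y\in V\cup\Omega$ lies in a strong component $C$ of $D-X$ if $y$ is a vertex of $C$ or an end living in $C$. - For a vertex $v$: the uniform star of radius $\varepsilon$ around $v$, that is, $v$ together with the half-open segments of length $\varepsilon$ at $v$ of all $e\in E\cup\Lambda$ incident with $v$. - For an end $\omega$: with $C=C(X,\omega)$, the set of all vertices and ends lying in $C$, all points of those $e\in E\cup\Lambda$ whose two endpoints both lie in $C$, and the half-open segments of length $\varepsilon$, starting at $y$, of all $e\in E\cup\Lambda$ with an endpoint $y$ lying in $C$. - For an inner point $z$ of an edge $e\in E$: the open ball of radius $\varepsilon$ around $z$ in $e$. - For an inner point $z$ of a limit edge $\omega\eta$ between ends, and $X$ with $C(X,\omega)\neq C(X,\eta)$: the union of the open balls of radius $\varepsilon$ around the points corresponding to $z$ on all $e\in E\cup\Lambda$ whose tail lies in $C(X,\omega)$ and whose head lies in $C(X,\eta)$. - For an inner point $z$ of a limit edge $v\omega$ (respectively $\omega v$), and $X$ with $v\in X$: the union of the open balls of radius $\varepsilon$ around the points corresponding to $z$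 on all $e\in E\cup\Lambda$ with tail $v$ and head lying in $C(X,\omega)$ (respectively with head $v$ and tail lying in $C(X,\omega)$). In the last three cases $\varepsilon$ is taken so small that the balls are contained in their edges. A necklace in $D$ consists of finite, non-empty, pairwise disjoint, strongly connected vertex sets $B_0,B_1,\dots$ (its beads) together with, for every $n$, a directed path from $B_n$ to $B_{n+1}$ and a directed path from $B_{n+1}$ to $B_n$, where the inner vertices of these paths avoid all beads and the paths are internally disjoint. It is attached to a set $U\subseteq V$ if infinitely many of its beads meet $U$. For a set $U$, the $U$-rank of digraphs is defined by transfinite recursion: a digraph $H$ has $U$-rank $0$ if $U\cap V(H)$ is finite; it has $U$-rank $\alpha>0$ if it has no $U$-rank $<\alpha$ and there is a finite $X\subseteq V(H)$ such that every strong component of $H-X$ has a $U$-rank $<\alpha$. The digraph $H$ has a $U$-rank if it has $U$-rank $\alpha$ for some ordinal $\alpha$. Then the following statements are equivalent: 1. $|D|$ is compact; 2. every set $U\subseteq V$ of vertices that is closed in $|D|$ is finite; 3. $D$ has no $U$-rank for any infinite $U\subseteq V$; 4. for every infinite $U\subseteq V$ there is a necklace in $D$ attached to $U$; 5. $D$ is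 solid, that is, $D-X$ has only finitely many strong components for every finite $X\subseteq V$. -/

import Mathlib

universe u

namespace Digraph

variable {V : Type u}

/-! ### Strong components -/

/-- `v` can reach `w` in the subdigraph `D[S]` induced on the vertex set `S`. -/
def ReachIn (D : Digraph V) (S : Set V) (v w : V) : Prop :=
  v ∈ S ∧ w ∈ S ∧ Relation.ReflTransGen (fun a b => a ∈ S ∧ b ∈ S ∧ D.Adj a b) v w

/-- The set of vertices of `D[S]` that `v` can reach in `D[S]` and that can reach `v` in `D[S]`.
If `v ∈ S`, this is the vertex set of the strong component of `D[S]` containing `v`. -/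
def strongComp (D : Digraph V) (S : Set V) (v : V) : Set V :=
  {w | D.ReachIn S v w ∧ D.ReachIn S w v}

/-- `C` is (the vertex set of) a strong component of `D[S]`. -/
def IsStrongComp (D : Digraph V) (S C : Set V) : Prop :=
  ∃ v ∈ S, C = D.strongComp S v

/-- The vertex set `W` is strongly connected in `D`: any vertex of `W` can reach any other one
inside `D[W]`. -/
def IsStronglyConnectedSet (D : Digraph V) (W : Set V) : Prop :=
  ∀ a ∈ W, ∀ b ∈ W, D.ReachIn W a b

/-- `D` is solid: `D - X` has only finitely many strong components, for every finite vertex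
set `X`. -/
def IsSolid (D : Digraph V) : Prop :=
  ∀ X : Finset V, {C : Set V | D.IsStrongComp (X : Set V)ᶜ C}.Finite

theorem strongComp_eq_of_mem (D : Digraph V) {S : Set V} {v w : V}
    (h : w ∈ D.strongComp S v) : D.strongComp S w = D.strongComp S v := by
  obtain ⟨⟨hv, hw, hvw⟩, ⟨-, -, hwv⟩⟩ := h
  ext x
  constructor
  · rintro ⟨⟨-, hx, h1⟩, ⟨-, -, h2⟩⟩
    exact ⟨⟨hv, hx, hvw.trans h1⟩, ⟨hx, hv, h2.trans hwv⟩⟩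
  · rintro ⟨⟨-, hx, h1⟩, ⟨-, -, h2⟩⟩
    exact ⟨⟨hw, hx, hwv.trans h1⟩, ⟨hx, hw, h2.trans hvw⟩⟩

theorem IsStrongComp.eq_of_mem {D : Digraph V} {S C C' : Set V} {w : V}
    (hC : D.IsStrongComp S C) (hC' : D.IsStrongComp S C') (h : w ∈ C) (h' : w ∈ C') :
    C = C' := by
  obtain ⟨v, -, rfl⟩ := hC
  obtain ⟨v', -, rfl⟩ := hC'
  rw [← D.strongComp_eq_of_mem h, ← D.strongComp_eq_of_mem h']

/-! ### Solid rays and ends -/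

/-- The sequence `r` of vertices has a tail in the vertex set `C`. -/
def HasTailIn (r : ℕ → V) (C : Set V) : Prop :=
  ∃ n, ∀ m, n ≤ m → r m ∈ C

/-- A solid ray of `D`: a directed ray `r 0, r 1, r 2, …` which has, for every finite vertex
set `X`, a tail in some strong component of `D - X`. -/
structure SolidRay (D : Digraph V) where
  toFun : ℕ → V
  injective : Function.Injective toFun
  adj : ∀ n, D.Adj (toFun n) (toFun (n + 1))
  solid : ∀ X : Finset V, ∃ C, D.IsStrongComp (X : Set V)ᶜ C ∧ HasTailIn toFun C

theorem HasTailIn.eq {D : Digraph V} {S C C' : Set V} {r : ℕ → V}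
    (hC : D.IsStrongComp S C) (hC' : D.IsStrongComp S C')
    (h : HasTailIn r C) (h' : HasTailIn r C') : C = C' := by
  obtain ⟨n, hn⟩ := h
  obtain ⟨n', hn'⟩ := h'
  exact hC.eq_of_mem hC' (hn (max n n') (le_max_left _ _)) (hn' (max n n') (le_max_right _ _))

/-- Two solid rays are equivalent if, for every finite vertex set `X`, they have a tail in the
same strong component of `D - X`. -/
def solidRaySetoid (D : Digraph V) : Setoid D.SolidRay where
  r R R' := ∀ X : Finset V, ∃ C, D.IsStrongComp (X : Set V)ᶜ C ∧
    HasTailIn R.toFun C ∧ HasTailIn R'.toFun C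
  iseqv :=
    { refl := fun R X => by
        obtain ⟨C, hC, h⟩ := R.solid X
        exact ⟨C, hC, h, h⟩
      symm := fun h X => by
        obtain ⟨C, hC, h1, h2⟩ := h X
        exact ⟨C, hC, h2, h1⟩
      trans := fun h h' X => by
        obtain ⟨C, hC, h1, h2⟩ := h X
        obtain ⟨C', hC', h3, h4⟩ := h' X
        obtain rfl := HasTailIn.eq hC hC' h2 h3
        exact ⟨C, hC, h1, h4⟩ }

/-- The set `Ω(D)` of ends of `D`. -/
def Ends (D : Digraph V) : Type u := Quotient D.solidRaySetoid

/-- The vertex set of the strong component of `D - X` in which the solid ray `R` has a tail. -/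
def SolidRay.comp {D : Digraph V} (R : D.SolidRay) (X : Finset V) : Set V :=
  {v | ∃ C, D.IsStrongComp (X : Set V)ᶜ C ∧ HasTailIn R.toFun C ∧ v ∈ C}

theorem SolidRay.comp_congr {D : Digraph V} {R R' : D.SolidRay}
    (h : D.solidRaySetoid.r R R') (X : Finset V) : R.comp X = R'.comp X := by
  obtain ⟨C, hC, h1, h2⟩ := h X
  ext v
  constructor
  · rintro ⟨C', hC', h3, hv⟩
    obtain rfl := HasTailIn.eq hC hC' h1 h3
    exact ⟨C, hC, h2, hv⟩
  · rintro ⟨C', hC', h3, hv⟩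
    obtain rfl := HasTailIn.eq hC hC' h2 h3
    exact ⟨C, hC, h1, hv⟩

/-- `C(X, ω)`: the vertex set of the strong component of `D - X` in which the end `ω` lives. -/
def Ends.comp {D : Digraph V} (ω : D.Ends) (X : Finset V) : Set V :=
  Quotient.lift (fun R : D.SolidRay => R.comp X) (fun _ _ h => SolidRay.comp_congr h X) ω

/-! ### Limit edges and the ground set of `|D|` -/

/-- The set `V ∪ Ω` of vertices and ends of `D`. -/
abbrev Node (D : Digraph V) : Type u := V ⊕ D.Ends

/-- `D.IsEdge x y` says that the pair `(x, y)` is an edge of `|D|` with tail `x` and head `y`.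
Pairs of vertices are edges of `D`; the other three cases are the three kinds of limit edges. -/
def IsEdge (D : Digraph V) : D.Node → D.Node → Prop
  | .inl v, .inl w => D.Adj v w
  | .inl v, .inr ω => ∀ X : Finset V, v ∉ ω.comp X → ∃ b ∈ ω.comp X, D.Adj v b
  | .inr ω, .inl v => ∀ X : Finset V, v ∉ ω.comp X → ∃ a ∈ ω.comp X, D.Adj a v
  | .inr ω, .inr η => ω ≠ η ∧ ∀ X : Finset V, ω.comp X ≠ η.comp X →
      ∃ a ∈ ω.comp X, ∃ b ∈ η.comp X, D.Adj a b

/-- The set `E ∪ Λ` of all edges and limit edges of `D`. -/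
structure Edge (D : Digraph V) where
  tail : D.Node
  head : D.Node
  isEdge : D.IsEdge tail head

/-- The ground set of `|D|`. Gluing a copy `[0,1]_e` of the unit interval to the vertices and ends
for every `e ∈ E ∪ Λ`, with `0` identified with the tail and `1` with the head of `e`, leaves
exactly the vertices and ends, together with the inner points `t ∈ (0,1)` of each edge. -/
inductive Space (D : Digraph V) : Type u
  | node (x : D.Node) : Space D
  | inner (e : D.Edge) (t : Set.Ioo (0 : ℝ) 1) : Space D

/-- The point of `|D|` given by a vertex. -/
def Space.vertex {D : Digraph V} (v : V) : D.Space := .node (.inl v)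

/-! ### The topology `DTop` -/

/-- For a strong component `C` of `D - X`: the vertex `v` is contained in `C`, respectively the
end `η` lives in `C`. -/
def Node.LiesIn {D : Digraph V} (X : Finset V) (C : Set V) : D.Node → Prop
  | .inl v => v ∈ C
  | .inr η => η.comp X = C

/-- The uniform star of radius `ε` around the vertex `v` (all edges and limit edges at `v`
contribute a half-open segment of length `ε`). -/
def Space.star {D : Digraph V} (v : V) (ε : ℝ) : Set D.Space :=
  {p | match p with
    | .node x => x = .inl v
    | .inner e t => (e.tail = .inl v ∧ (t : ℝ) < ε) ∨ (e.head = .inl v ∧ 1 - ε < (t : ℝ))}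

/-- The neighbourhood `Ĉ_ε(X, ω)` of the end `ω`. It consists of the vertices contained in
`C = C(X, ω)`, the ends living in `C`, all inner points of the edges of `C` and of the limit edges
living in `C` (these are the edges of `|D|` with both endpoints lying in `C`), and half-open
segments of length `ε`, starting at `y`, of all edges and limit edges that have an endpoint `y`
lying in `C`. -/
def Space.endNhd {D : Digraph V} (X : Finset V) (ω : D.Ends) (ε : ℝ) : Set D.Space :=
  {p | match p with
    | .node x => Node.LiesIn X (ω.comp X) x
    | .inner e t =>
        (Node.LiesIn X (ω.comp X) e.tail ∧ Node.LiesIn X (ω.comp X) e.head) ∨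
        (Node.LiesIn X (ω.comp X) e.tail ∧ (t : ℝ) < ε) ∨
        (Node.LiesIn X (ω.comp X) e.head ∧ 1 - ε < (t : ℝ))}

/-- The finite vertex sets `X` admitted in the neighbourhoods of inner points of the edge of `|D|`
from `x` to `y`: for a limit edge between two ends, `X` has to separate these ends; for a limit
edge between a vertex and an end, `X` has to contain the vertex; for an edge of `D`, the set `X`
plays no role. -/
def Node.Admits {D : Digraph V} (X : Finset V) : D.Node → D.Node → Prop
  | .inl _, .inl _ => True
  | .inl v, .inr _ => v ∈ X
  | .inr _, .inl v => v ∈ X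
  | .inr ω, .inr η => ω.comp X ≠ η.comp X

/-- One side of a bundle: `y` lies on the side of `x` if `x` is a vertex and `y = x`, or if `x` is
an end and `y` is contained in or lives in `C(X, x)`. -/
def Node.SameSide {D : Digraph V} (X : Finset V) : D.Node → D.Node → Prop
  | .inl v, y => y = .inl v
  | .inr ω, y => Node.LiesIn X (ω.comp X) y

/-- The basic neighbourhoods of the inner point `t` of an edge `e` of `|D|`. If `e` is a limit
edge, this is `Ê_{ε,t}(X, e)`: the union of the open balls of radius `ε` around the points
corresponding to `t` on all edges in the bundle `E(X, e)` and on all limit edges living in this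
bundle. If `e` is an edge of `D`, this is the open ball of radius `ε` around `t` in `e`. -/
def Space.edgeNhd {D : Digraph V} (X : Finset V) (e : D.Edge) (t ε : ℝ) : Set D.Space :=
  {p | match p with
    | .node _ => False
    | .inner f s => Node.SameSide X e.tail f.tail ∧ Node.SameSide X e.head f.head ∧
        |(s : ℝ) - t| < ε}

/-- The basic open sets of `DTop`. In the last case the radius is small enough for the open balls
to be contained in their edges. -/
inductive Space.IsBasicOpen {D : Digraph V} : Set D.Space → Prop
  | star (v : V) (ε : ℝ) (hε : 0 < ε) (hε' : ε ≤ 1) : IsBasicOpen (Space.star v ε)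
  | endNhd (X : Finset V) (ω : D.Ends) (ε : ℝ) (hε : 0 < ε) (hε' : ε ≤ 1) :
      IsBasicOpen (Space.endNhd X ω ε)
  | edgeNhd (X : Finset V) (e : D.Edge) (hX : Node.Admits X e.tail e.head)
      (t : Set.Ioo (0 : ℝ) 1) (ε : ℝ) (hε : 0 < ε) (hε₀ : ε ≤ t) (hε₁ : ε ≤ 1 - t) :
      IsBasicOpen (Space.edgeNhd X e t ε)

/-- The topology `DTop` on `|D|`. -/
instance Space.instTopologicalSpace (D : Digraph V) : TopologicalSpace D.Space :=
  TopologicalSpace.generateFrom {s | Space.IsBasicOpen s}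

/-! ### Necklaces -/

/-- A necklace in `D`: an inflated symmetric ray with finite branch sets (its beads). The beads are
finite non-empty disjoint strongly connected vertex sets `bead n`. For every `n` there is a path
from `bead n` to `bead (n + 1)` with set of inner vertices `inner (n, true)`, and a path from
`bead (n + 1)` to `bead n` with inner vertices `inner (n, false)`. The inner vertices of all these
paths avoid all beads, and the paths are internally disjoint. -/
structure Necklace (D : Digraph V) where
  bead : ℕ → Finset V
  bead_nonempty : ∀ n, (bead n).Nonempty
  bead_strong : ∀ n, D.IsStronglyConnectedSet (bead n : Set V)
  bead_disjoint : ∀ m n, m ≠ n → Disjoint (bead m) (bead n)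
  inner : ℕ × Bool → List V
  forth : ∀ n, ∃ a ∈ bead n, ∃ b ∈ bead (n + 1),
    List.IsChain D.Adj (a :: (inner (n, true) ++ [b]))
  back : ∀ n, ∃ a ∈ bead (n + 1), ∃ b ∈ bead n,
    List.IsChain D.Adj (a :: (inner (n, false) ++ [b]))
  inner_nodup : ∀ i, (inner i).Nodup
  inner_notMem_bead : ∀ i, ∀ v ∈ inner i, ∀ n, v ∉ bead n
  inner_disjoint : ∀ i j, i ≠ j → List.Disjoint (inner i) (inner j)

/-- The necklace `N` is attached to `U`: infinitely many beads of `N` meet `U`. -/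
def Necklace.IsAttachedTo {D : Digraph V} (N : D.Necklace) (U : Set V) : Prop :=
  {n : ℕ | ∃ v ∈ N.bead n, v ∈ U}.Infinite

/-! ### The rank -/

/-- `D.HasRankOn U α W` says that the digraph `D[W]` has `U`-rank `α`. It has `U`-rank `0` if
`U ∩ W` is finite, and it has `U`-rank `α > 0` if it has no `U`-rank `< α` and there is a finite
set `X` of its vertices such that every strong component of `D[W] - X` has a `U`-rank `< α`. -/
def HasRankOn (D : Digraph V) (U : Set V) (α : Ordinal.{u}) (W : Set V) : Prop :=
  (α = 0 ∧ (U ∩ W).Finite) ∨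
  (α ≠ 0 ∧ (∀ β, ∀ _ : β < α, ¬ D.HasRankOn U β W) ∧
    ∃ X : Finset V, (X : Set V) ⊆ W ∧
      ∀ C, D.IsStrongComp (W \ X) C → ∃ β, ∃ _ : β < α, D.HasRankOn U β C)
termination_by α

/-- `D` has a `U`-rank. -/
def HasRank (D : Digraph V) (U : Set V) : Prop :=
  ∃ α : Ordinal.{u}, D.HasRankOn U α Set.univ

end Digraph

/-!
A solid digraph is one in which every `D - X` falls into finitely many strong components, and each
of the other conditions is compared with this one.

If `D` is not solid, choose one vertex from each of infinitely many strong components of some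
`D - X` (`exists_infinite_of_not_isSolid`). The resulting infinite set `U` is closed in `|D|`, since
it has at most one vertex in the component in which a given end lives; `D` has `U`-rank at most `1`;
and no necklace is attached to `U`, since almost all beads of a necklace lie in the same strong
component of `D - X` (`Necklace.exists_isStrongComp`). A closed vertex set is discrete, so compactness
of `|D|` makes it finite.

Conversely let `D` be solid. That `D` has no `U`-rank is an induction on the rank: among finitely
many components one contains infinitely many vertices of `U`. For the two remaining properties the
tool is the notion of a direction, a consistent choice of a strong component of `D - X` for every
finite `X`. Every ultrafilter on vertices and ends which is not principal at a vertex defines a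
direction, by solidity (`IsSolid.exists_direction`).

* If every component chosen by a direction meets `U`, a necklace attached to `U` is built along it
  bead by bead (`Direction.exists_necklace`).
* Every direction, in any digraph of any cardinality, is given by an end (`Direction.exists_end`).
  The point is to find one sequence of vertices that is eventually contained in every component
  chosen by the direction (`Direction.exists_seq`).

So every ultrafilter on vertices and ends has a limit. For an ultrafilter on inner points of edges,
let `x` and `y` be the limits of their tails and heads, and `s` the limit of their positions in
`[0, 1]`. If `x ≠ y` then `(x, y)` is an edge or a limit edge (`isEdge_of_eventually`), and the
ultrafilter converges to its point at `s`, or to `x` or `y` if `s` is `0` or `1`. If `x = y` then it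
converges to `x`, which for `0 < s < 1` has to be an end as there are no loops. Hence `|D|` is
compact.
-/

namespace Digraph

variable {V : Type u} {D : Digraph V}

/-! ### Reachability and strong components -/

theorem ReachIn.refl {S : Set V} {v : V} (hv : v ∈ S) : D.ReachIn S v v :=
  ⟨hv, hv, .refl⟩

theorem ReachIn.trans {S : Set V} {a b c : V} (h : D.ReachIn S a b) (h' : D.ReachIn S b c) :
    D.ReachIn S a c :=
  ⟨h.1, h'.2.1, h.2.2.trans h'.2.2⟩

theorem ReachIn.single {S : Set V} {a b : V} (ha : a ∈ S) (hb : b ∈ S) (h : D.Adj a b) :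
    D.ReachIn S a b :=
  ⟨ha, hb, .single ⟨ha, hb, h⟩⟩

theorem ReachIn.mono {S T : Set V} (hST : S ⊆ T) {a b : V} (h : D.ReachIn S a b) :
    D.ReachIn T a b :=
  ⟨hST h.1, hST h.2.1,
    Relation.ReflTransGen.mono (fun _ _ h => ⟨hST h.1, hST h.2.1, h.2.2⟩) _ _ h.2.2⟩

theorem strongComp_subset {S : Set V} {v : V} : D.strongComp S v ⊆ S :=
  fun _ h => h.1.2.1

theorem mem_strongComp_self {S : Set V} {v : V} (hv : v ∈ S) : v ∈ D.strongComp S v :=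
  ⟨.refl hv, .refl hv⟩

theorem isStrongComp_strongComp {S : Set V} {v : V} (hv : v ∈ S) :
    D.IsStrongComp S (D.strongComp S v) :=
  ⟨v, hv, rfl⟩

theorem IsStrongComp.subset {S C : Set V} (hC : D.IsStrongComp S C) : C ⊆ S := by
  obtain ⟨v, -, rfl⟩ := hC
  exact strongComp_subset

theorem IsStrongComp.nonempty {S C : Set V} (hC : D.IsStrongComp S C) : C.Nonempty := by
  obtain ⟨v, hv, rfl⟩ := hC
  exact ⟨v, mem_strongComp_self hv⟩

theorem IsStrongComp.eq_strongComp {S C : Set V} (hC : D.IsStrongComp S C) {v : V}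
    (hv : v ∈ C) : C = D.strongComp S v := by
  obtain ⟨w, -, rfl⟩ := hC
  exact (D.strongComp_eq_of_mem hv).symm

theorem IsStrongComp.mem_of_reach {S C : Set V} (hC : D.IsStrongComp S C) {v w w' : V}
    (hv : v ∈ C) (hw' : w' ∈ C) (h : D.ReachIn S v w) (h' : D.ReachIn S w w') : w ∈ C := by
  rw [hC.eq_strongComp hv] at hw' ⊢
  exact ⟨h, h'.trans hw'.2⟩

theorem IsStrongComp.isStronglyConnectedSet {S C : Set V} (hC : D.IsStrongComp S C) :
    D.IsStronglyConnectedSet C := by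
  intro a ha b hb
  have hab : D.ReachIn S a b := by
    rw [hC.eq_strongComp ha] at hb
    exact hb.1
  obtain ⟨-, hbS, h⟩ := hab
  induction h using Relation.ReflTransGen.head_induction_on with
  | refl => exact .refl hb
  | @head x y hxy hyb ih =>
    have hy : y ∈ C := hC.mem_of_reach ha hb (.single hxy.1 hxy.2.1 hxy.2.2) ⟨hxy.2.1, hbS, hyb⟩
    exact (ReachIn.single ha hy hxy.2.2).trans (ih hy)

theorem IsStronglyConnectedSet.subset_isStrongComp {S C W : Set V}
    (hW : D.IsStronglyConnectedSet W) (hWS : W ⊆ S) (hC : D.IsStrongComp S C) {w : V}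
    (hw : w ∈ W) (hwC : w ∈ C) : W ⊆ C := fun x hx =>
  hC.mem_of_reach hwC hwC ((hW w hw x hx).mono hWS) ((hW x hx w hw).mono hWS)

theorem IsStrongComp.subset_of_mem {S T C C' : Set V} (hC : D.IsStrongComp S C)
    (hC' : D.IsStrongComp T C') (hTS : T ⊆ S) {w : V} (hw : w ∈ C) (hw' : w ∈ C') : C' ⊆ C :=
  hC'.isStronglyConnectedSet.subset_isStrongComp (hC'.subset.trans hTS) hC hw' hw

/-- A set all of whose points lie on closed walks through one point `v` is strongly connected. -/
theorem isStronglyConnectedSet_of_center {W : Set V} (v : V)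
    (h : ∀ w ∈ W, D.ReachIn W v w ∧ D.ReachIn W w v) : D.IsStronglyConnectedSet W :=
  fun a ha b hb => (h a ha).2.trans (h b hb).1

/-- If `a` reaches `b` in `D[S]`, it does so in `D[P]` for a finite `P ⊆ S`, all of whose vertices can be
chosen to lie on the way from `a` to `b`. -/
theorem ReachIn.exists_finset {S : Set V} {a b : V} (h : D.ReachIn S a b) :
    ∃ P : Finset V, (P : Set V) ⊆ S ∧ a ∈ P ∧ b ∈ P ∧
      ∀ w ∈ P, D.ReachIn P a w ∧ D.ReachIn P w b := by
  classical
  obtain ⟨ha, -, h⟩ := h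
  induction h with
  | refl => exact ⟨{a}, by simpa using ha, by simp, by simp, by
      intro w hw
      obtain rfl := Finset.mem_singleton.1 hw
      exact ⟨.refl hw, .refl hw⟩⟩
  | @tail b c _ hbc ih =>
    obtain ⟨P, hPS, haP, hbP, hP⟩ := ih
    have hsub : (P : Set V) ⊆ (insert c P : Finset V) := by simp
    have hcP : c ∈ ((insert c P : Finset V) : Set V) := by simp
    have hlast : D.ReachIn (insert c P : Finset V) b c := .single (hsub hbP) hcP hbc.2.2
    refine ⟨insert c P, ?_, hsub haP, hcP, fun w hw => ?_⟩
    · rw [Finset.coe_insert]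
      exact Set.insert_subset hbc.2.1 hPS
    · obtain rfl | hw := Finset.mem_insert.1 hw
      · exact ⟨((hP b hbP).1.mono hsub).trans hlast, .refl hcP⟩
      · exact ⟨(hP w hw).1.mono hsub, ((hP w hw).2.mono hsub).trans hlast⟩

/-- Finite subsets of strongly connected sets extend to finite strongly connected sets: add closed
walks from one of the vertices to all others. -/
theorem IsStronglyConnectedSet.exists_finset {C : Set V} (hC : D.IsStronglyConnectedSet C)
    (F : Finset V) (hF : (F : Set V) ⊆ C) :
    ∃ W : Finset V, F ⊆ W ∧ (W : Set V) ⊆ C ∧ D.IsStronglyConnectedSet W := by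
  classical
  obtain rfl | ⟨v, hv⟩ := F.eq_empty_or_nonempty
  · exact ⟨∅, subset_rfl, by simp, fun a ha => by simp at ha⟩
  have key : ∀ x ∈ F, ∃ W : Finset V, x ∈ W ∧ (W : Set V) ⊆ C ∧
      ∀ w ∈ W, D.ReachIn W v w ∧ D.ReachIn W w v := by
    intro x hx
    obtain ⟨P, hPC, hvP, hxP, hP⟩ := (hC v (hF hv) x (hF hx)).exists_finset
    obtain ⟨Q, hQC, hxQ, hvQ, hQ⟩ := (hC x (hF hx) v (hF hv)).exists_finset
    have hPs : (P : Set V) ⊆ (P ∪ Q : Finset V) := by simp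
    have hQs : (Q : Set V) ⊆ (P ∪ Q : Finset V) := by simp
    refine ⟨P ∪ Q, hPs hxP, by simpa using ⟨hPC, hQC⟩, fun w hw => ?_⟩
    have h1 : D.ReachIn (P ∪ Q : Finset V) v x := (hP x hxP).1.mono hPs
    have h2 : D.ReachIn (P ∪ Q : Finset V) x v := (hQ x hxQ).2.mono hQs
    obtain hw | hw := Finset.mem_union.1 hw
    · exact ⟨(hP w hw).1.mono hPs, ((hP w hw).2.mono hPs).trans h2⟩
    · exact ⟨h1.trans ((hQ w hw).1.mono hQs), (hQ w hw).2.mono hQs⟩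
  choose! W hxW hWC hW using key
  have hsub : ∀ x ∈ F, (W x : Set V) ⊆ (F.biUnion W : Finset V) := fun x hx =>
    Finset.coe_subset.2 (Finset.subset_biUnion_of_mem W hx)
  refine ⟨F.biUnion W, fun x hx => hsub x hx (hxW x hx), ?_, isStronglyConnectedSet_of_center v ?_⟩
  · intro y hy
    obtain ⟨x, hx, hy⟩ := Finset.mem_biUnion.1 hy
    exact hWC x hx hy
  · intro w hw
    obtain ⟨x, hx, hw⟩ := Finset.mem_biUnion.1 hw
    exact ⟨(hW x hx w hw).1.mono (hsub x hx), (hW x hx w hw).2.mono (hsub x hx)⟩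

/-- Strong components of a strong component, after deleting further vertices, are strong
components of the ambient digraph. -/
theorem IsStrongComp.of_sdiff {S C Y C' : Set V} (hC : D.IsStrongComp S C)
    (hC' : D.IsStrongComp (C \ Y) C') : D.IsStrongComp (S \ Y) C' := by
  obtain ⟨v, hv, rfl⟩ := hC'
  have hsub : C \ Y ⊆ S \ Y := Set.sdiff_subset_sdiff_left hC.subset
  refine ⟨v, hsub hv, subset_antisymm
    (fun w hw => ⟨hw.1.mono hsub, hw.2.mono hsub⟩) ?_⟩
  have hK := isStrongComp_strongComp (D := D) (hsub hv)
  have hvK := mem_strongComp_self (D := D) (hsub hv)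
  have hKC : D.strongComp (S \ Y) v ⊆ C \ Y := fun w hw =>
    ⟨hC.subset_of_mem hK Set.sdiff_subset hv.1 hvK hw, (strongComp_subset hw).2⟩
  exact fun w hw => ⟨(hK.isStronglyConnectedSet v hvK w hw).mono hKC,
    (hK.isStronglyConnectedSet w hw v hvK).mono hKC⟩

/-- In a digraph that is not solid, choosing one vertex from each of infinitely many strong
components of some `D - X` gives an infinite set that is spread out over these components. -/
theorem exists_infinite_of_not_isSolid (h : ¬ D.IsSolid) :
    ∃ (X : Finset V) (U : Set V), U.Infinite ∧
      ∀ C, D.IsStrongComp (X : Set V)ᶜ C → (U ∩ C).Subsingleton := by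
  simp only [IsSolid, not_forall] at h
  obtain ⟨X, hX⟩ := h
  have hne : ∀ C : Set V, D.IsStrongComp (X : Set V)ᶜ C → ∃ v, v ∈ C := fun C hC => hC.nonempty
  have : Nonempty V := by
    obtain ⟨C, hC⟩ := Set.Infinite.nonempty hX
    exact ⟨hC.nonempty.some⟩
  choose! f hf using hne
  refine ⟨X, f '' {C | D.IsStrongComp (X : Set V)ᶜ C}, ?_, ?_⟩
  · refine Set.Infinite.image ?_ hX
    intro C hC C' hC' hCC'
    exact IsStrongComp.eq_of_mem hC hC' (hf C hC) (hCC' ▸ hf C' hC')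
  · rintro C hC _ ⟨⟨A, hA, rfl⟩, hAC⟩ _ ⟨⟨B, hB, rfl⟩, hBC⟩
    rw [IsStrongComp.eq_of_mem hA hC (hf A hA) hAC, IsStrongComp.eq_of_mem hB hC (hf B hB) hBC]

/-! ### Ranks and solidity -/

theorem hasRankOn_zero_iff {U W : Set V} : D.HasRankOn U 0 W ↔ (U ∩ W).Finite := by
  rw [HasRankOn]
  simp

/-- If every `D[W] - Y` has finitely many strong components and `D[W]` has a `U`-rank, then `U ∩ W` is
finite. The condition on `W` passes to the strong components `C` of `D[W] - X`, as the components of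
`C - Y` are components of `D[W] - (X ∪ Y)`. -/
theorem HasRankOn.finite_inter {U : Set V} (α : Ordinal.{u}) : ∀ {W : Set V},
    (∀ Y : Finset V, {C | D.IsStrongComp (W \ Y) C}.Finite) → D.HasRankOn U α W →
      (U ∩ W).Finite := by
  classical
  induction α using WellFoundedLT.induction with
  | ind α ih =>
    intro W hW h
    rw [HasRankOn] at h
    obtain ⟨-, h⟩ | ⟨-, -, X, -, hX⟩ := h
    · exact h
    have hfin : ∀ C, D.IsStrongComp (W \ X) C → (U ∩ C).Finite := by
      intro C hC
      obtain ⟨β, hβ, hr⟩ := hX C hC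
      refine ih β hβ (fun Y => (hW (X ∪ Y)).subset fun C' hC' => ?_) hr
      have := hC.of_sdiff hC'
      rwa [Set.sdiff_sdiff, ← Finset.coe_union] at this
    refine (X.finite_toSet.union ((hW X).biUnion hfin)).subset ?_
    rintro v ⟨hvU, hvW⟩
    by_cases hvX : v ∈ X
    · exact .inl hvX
    · exact .inr (Set.mem_biUnion (isStrongComp_strongComp ⟨hvW, hvX⟩)
        ⟨hvU, mem_strongComp_self ⟨hvW, hvX⟩⟩)

theorem IsSolid.not_hasRank (hD : D.IsSolid) {U : Set V} (hU : U.Infinite) : ¬ D.HasRank U := by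
  rintro ⟨α, h⟩
  refine hU ?_
  simpa using h.finite_inter α fun Y => by simpa [← Set.compl_eq_univ_sdiff] using hD Y

theorem isSolid_of_forall_not_hasRank (h : ∀ U : Set V, U.Infinite → ¬ D.HasRank U) :
    D.IsSolid := by
  by_contra hD
  obtain ⟨X, U, hU, hUC⟩ := exists_infinite_of_not_isSolid hD
  refine h U hU ⟨1, ?_⟩
  rw [HasRankOn]
  refine .inr ⟨one_ne_zero, fun β hβ hr => ?_, X, Set.subset_univ _, fun C hC => ?_⟩
  · obtain rfl := Order.lt_one_iff.1 hβ
    rw [hasRankOn_zero_iff, Set.inter_univ] at hr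
    exact hU hr
  · rw [← Set.compl_eq_univ_sdiff] at hC
    exact ⟨0, zero_lt_one, hasRankOn_zero_iff.2 (hUC C hC).finite⟩

/-! ### Directions -/

/-- A direction of `D` chooses a strong component of `D - X` for every finite vertex set `X`,
consistently: if `X ⊆ Y` then the component chosen for `Y` is contained in the one for `X`. -/
structure Direction (D : Digraph V) where
  comp : Finset V → Set V
  isStrongComp : ∀ X : Finset V, D.IsStrongComp (X : Set V)ᶜ (comp X)
  anti : ∀ X Y, X ⊆ Y → comp Y ⊆ comp X

namespace Direction

theorem notMem_of_mem_comp (c : D.Direction) {X Y : Finset V} (hYX : Y ⊆ X) {v : V} (hv : v ∈ c.comp X) :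
    v ∉ Y :=
  fun h => (c.isStrongComp X).subset hv (hYX h)

theorem subset_of_strong (c : D.Direction) {X : Finset V} {W : Set V}
    (hW : D.IsStronglyConnectedSet W) (hWX : ∀ w ∈ W, w ∉ X) {w : V} (hw : w ∈ W)
    (hwc : w ∈ c.comp X) : W ⊆ c.comp X :=
  hW.subset_isStrongComp hWX (c.isStrongComp X) hw hwc

/-- A component chosen by a direction is contained in every other one whose deleted set it
avoids. -/
theorem comp_subset_comp (c : D.Direction) {X Y : Finset V}
    (h : ∀ v ∈ c.comp X, v ∉ Y) : c.comp X ⊆ c.comp Y := by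
  classical
  obtain ⟨v, hv⟩ := (c.isStrongComp (X ∪ Y)).nonempty
  exact c.subset_of_strong (c.isStrongComp X).isStronglyConnectedSet h
    (c.anti _ _ Finset.subset_union_left hv) (c.anti _ _ Finset.subset_union_right hv)

end Direction

/-- Dependent choice along `ℕ`. -/
theorem exists_seq_of_forall_exists {α : Type*} (P : ℕ → α → Prop) (R : ℕ → α → α → Prop)
    (h0 : ∃ a, P 0 a) (hs : ∀ n a, P n a → ∃ b, P (n + 1) b ∧ R n a b) :
    ∃ f : ℕ → α, (∀ n, P n (f n)) ∧ ∀ n, R n (f n) (f (n + 1)) := by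
  obtain ⟨a, ha⟩ := h0
  choose g hg hR using hs
  let F : ∀ n, {a // P n a} := fun n =>
    Nat.rec ⟨a, ha⟩ (fun n x => ⟨g n x.1 x.2, hg n x.1 x.2⟩) n
  exact ⟨fun n => (F n).1, fun n => (F n).2, fun n => hR n (F n).1 (F n).2⟩

open Filter in
/-- If some vertex `b` can be separated from the direction, beyond a fixed finite set `Z`, by finite
sets avoiding any prescribed finite set, then the direction is captured by countably many of its
components, with empty intersection: a closed walk through `b` and a common vertex of these
components would have to meet infinitely many disjoint separators. -/
theorem Direction.exists_seq_of_separable (c : D.Direction) {Z : Finset V} {b : V}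
    (hb : b ∈ c.comp Z)
    (h : ∀ Z' : Finset V, ∃ F : Finset V, (∀ v ∈ F, v ∉ Z') ∧ ∀ Y, Z ⊆ Y → F ⊆ Y → b ∉ c.comp Y) :
    ∃ f : ℕ → V, ∀ X, ∀ᶠ n in atTop, f n ∈ c.comp X := by
  classical
  choose F hFd hFb using h
  obtain ⟨Y, -, hY⟩ := exists_seq_of_forall_exists (fun _ (_ : Finset V) => True)
    (fun _ Y Y' => Y' = Y ∪ F Y) ⟨Z, trivial⟩ fun _ Y _ => ⟨_, trivial, rfl⟩
  have hYm : Monotone Y := monotone_nat_of_le_succ fun n => by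
    rw [hY]; exact Finset.subset_union_left
  let X : ℕ → Finset V := fun n => Z ∪ Y n
  have hXm : Monotone X := fun m n hmn => Finset.union_subset_union_right (hYm hmn)
  have hempty : ∀ x, ∃ n, x ∉ c.comp (X n) := by
    intro x
    by_contra! hx
    have hxZ : x ∈ c.comp Z := c.anti _ _ Finset.subset_union_left (hx 0)
    obtain ⟨W, hW, hWc, hWs⟩ := (c.isStrongComp Z).isStronglyConnectedSet.exists_finset {b, x} (by
      intro y hy
      obtain rfl | hy := Finset.mem_insert.1 hy
      · exact hb
      · rwa [Finset.mem_singleton.1 hy])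
    have hWb : b ∈ W := hW (by simp)
    have hWx : x ∈ W := hW (by simp)
    -- every separator `F (Y n)` meets `W`, so that `W ∩ Y n` increases for ever
    have hmeet : ∀ n, ∃ w ∈ W, w ∈ F (Y n) := by
      intro n
      by_contra! hn
      have hsub : (W : Set V) ⊆ c.comp (Z ∪ F (Y n)) := by
        refine c.subset_of_strong hWs (fun w hw hw' => ?_) hWx ?_
        · obtain hw' | hw' := Finset.mem_union.1 hw'
          · exact c.notMem_of_mem_comp subset_rfl (hWc hw) hw'
          · exact hn w hw hw'
        · refine c.anti _ (X (n + 1)) ?_ (hx _)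
          refine Finset.union_subset_union_right ?_
          rw [hY]
          exact Finset.subset_union_right
      exact hFb (Y n) _ Finset.subset_union_left Finset.subset_union_right (hsub hWb)
    have hstrict : StrictMono fun n => W ∩ Y n := by
      refine strictMono_nat_of_lt_succ fun n => ?_
      obtain ⟨w, hwW, hwF⟩ := hmeet n
      refine Finset.ssubset_iff_of_subset
        (Finset.inter_subset_inter_left (hYm (Nat.le_succ n))) |>.2 ⟨w, ?_, ?_⟩
      · rw [hY]
        simp [hwW, hwF]
      · simp only [Finset.mem_inter, not_and]
        exact fun _ => hFd _ w hwF
    have hcard : ∀ n, n ≤ (W ∩ Y n).card := fun n => by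
      simpa using (Finset.card_strictMono.comp hstrict).id_le n
    have := (hcard (W.card + 1)).trans (Finset.card_le_card Finset.inter_subset_left)
    omega
  choose f hf using fun n => (c.isStrongComp (X n)).nonempty
  choose N hN using hempty
  refine ⟨f, fun S => ?_⟩
  filter_upwards [eventually_ge_atTop (S.sup N)] with n hn
  refine c.comp_subset_comp (fun v hv hvS => hN v ?_) (hf n)
  exact c.anti _ _ (hXm ((Finset.le_sup hvS).trans hn)) hv

open Filter in
/-- A direction is witnessed by a single sequence of vertices. Either some vertex is separated from
the direction by infinitely many disjoint finite sets, or every vertex `b` of every component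
`C(Z)` comes with a finite set `Z'` such that deleting finitely many vertices outside `Z'` never
separates `b` from the direction; in the latter case iterate `Z ↦ Z ∪ Z'`. -/
theorem Direction.exists_seq (c : D.Direction) :
    ∃ f : ℕ → V, ∀ X, ∀ᶠ n in atTop, f n ∈ c.comp X := by
  classical
  by_cases h : ∃ Z b, b ∈ c.comp Z ∧ ∀ Z' : Finset V, ∃ F : Finset V,
      (∀ v ∈ F, v ∉ Z') ∧ ∀ Y, Z ⊆ Y → F ⊆ Y → b ∉ c.comp Y
  · obtain ⟨Z, b, hb, h⟩ := h
    exact c.exists_seq_of_separable hb h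
  push Not at h
  choose β hβ using fun Z => (c.isStrongComp Z).nonempty
  choose Z' hZ' using fun Z => h Z (β Z) (hβ Z)
  obtain ⟨Z, -, hZ⟩ := exists_seq_of_forall_exists (fun _ (_ : Finset V) => True)
    (fun _ Y Y₁ => Y₁ = Y ∪ Z' Y) ⟨∅, trivial⟩ fun _ Y _ => ⟨_, trivial, rfl⟩
  have hZm : Monotone Z := monotone_nat_of_le_succ fun n => by
    rw [hZ]; exact Finset.subset_union_left
  refine ⟨fun n => β (Z n), fun X => ?_⟩
  -- from some index on, the finite set `X` meets `Z (n + 1)` only inside `Z n`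
  have hev : ∀ x : V, ∃ N, ∀ n, x ∈ Z n → x ∈ Z N := by
    intro x
    by_cases hx : ∃ N, x ∈ Z N
    · obtain ⟨N, hN⟩ := hx
      exact ⟨N, fun _ _ => hN⟩
    · push Not at hx
      exact ⟨0, fun n hn => absurd hn (hx n)⟩
  choose N hN using hev
  filter_upwards [eventually_ge_atTop (X.sup N)] with n hn
  obtain ⟨Y, hZY, hFY, hY⟩ := hZ' (Z n) (X \ Z n) (by
    intro v hv hv'
    rw [Finset.mem_sdiff] at hv
    refine hv.2 (hZm ((Finset.le_sup hv.1).trans hn) (hN v (n + 1) ?_))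
    rw [hZ]
    exact Finset.mem_union_right _ hv')
  refine c.anti _ _ ?_ hY
  intro x hx
  by_cases hxZ : x ∈ Z n
  · exact hZY hxZ
  · exact hFY (Finset.mem_sdiff.2 ⟨hx, hxZ⟩)

/-! ### Rays along a direction -/

theorem exists_fun_of_transGen {α : Type*} {r : α → α → Prop} {a b : α}
    (h : Relation.TransGen r a b) :
    ∃ (k : ℕ) (p : ℕ → α), p 0 = a ∧ p (k + 1) = b ∧ ∀ i ≤ k, r (p i) (p (i + 1)) := by
  induction h using Relation.TransGen.head_induction_on with
  | @single a h => exact ⟨0, fun i => if i = 0 then a else b, by simp, by simp, by simpa using h⟩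
  | @head a a' h _ ih =>
    obtain ⟨k, p, h0, hk, hp⟩ := ih
    refine ⟨k + 1, fun i => Nat.casesOn i a p, rfl, hk, fun i hi => ?_⟩
    cases i with
    | zero => simpa [h0] using h
    | succ i => exact hp i (by omega)

open Filter in
/-- Concatenation of infinitely many finite walks, the `n`-th one along the relation `r n`. -/
theorem exists_concatenation {α : Type*} {r : ℕ → α → α → Prop} {v : ℕ → α}
    (h : ∀ n, Relation.TransGen (r n) (v n) (v (n + 1))) :
    ∃ w : ℕ → α, ∀ N, ∀ᶠ i in atTop, ∃ n ≥ N, r n (w i) (w (i + 1)) := by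
  choose k p h0 hk hp using fun n => exists_fun_of_transGen (h n)
  -- the position `(n, i)` is the `i`-th step of the `n`-th walk
  obtain ⟨s, hs, hstep⟩ := exists_seq_of_forall_exists (fun _ (s : ℕ × ℕ) => s.2 ≤ k s.1)
    (fun _ s s' => s' = if s.2 < k s.1 then (s.1, s.2 + 1) else (s.1 + 1, 0))
    ⟨(0, 0), Nat.zero_le _⟩ (fun _ s hs => ⟨_, by
      split_ifs with hlt
      · exact hlt
      · exact Nat.zero_le _, rfl⟩)
  have hmono : Monotone fun i => (s i).1 := monotone_nat_of_le_succ fun i => by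
    rw [hstep]
    split_ifs <;> simp
  have hnext : ∀ d i, k (s i).1 - (s i).2 = d → ∃ j, (s j).1 = (s i).1 + 1 := by
    intro d
    induction d with
    | zero =>
      intro i hi
      exact ⟨i + 1, by rw [hstep, if_neg (by omega)]⟩
    | succ d ih =>
      intro i hi
      have hs' : s (i + 1) = ((s i).1, (s i).2 + 1) := by rw [hstep, if_pos (by omega)]
      obtain ⟨j, hj⟩ := ih (i + 1) (by rw [hs']; dsimp only; omega)
      exact ⟨j, by rw [hj, hs']⟩
  have hunb : ∀ N, ∃ i, N ≤ (s i).1 := by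
    intro N
    induction N with
    | zero => exact ⟨0, Nat.zero_le _⟩
    | succ N ih =>
      obtain ⟨i, hi⟩ := ih
      obtain ⟨j, hj⟩ := hnext _ i rfl
      exact ⟨j, by omega⟩
  refine ⟨fun i => p (s i).1 (s i).2, fun N => ?_⟩
  obtain ⟨i₀, hi₀⟩ := hunb N
  filter_upwards [eventually_ge_atTop i₀] with i hi
  refine ⟨(s i).1, hi₀.trans (hmono hi), ?_⟩
  have h1 := hp (s i).1 (s i).2 (hs i)
  have h2 : p (s (i + 1)).1 (s (i + 1)).2 = p (s i).1 ((s i).2 + 1) := by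
    rw [hstep]
    split_ifs with hlt
    · rfl
    · have : (s i).2 = k (s i).1 := le_antisymm (hs i) (not_lt.1 hlt)
      rw [this, hk, h0]
  rwa [h2]

open Filter in
/-- Loop erasure: an infinite walk that visits every vertex only finitely often contains a ray,
which follows the walk along its last visits to vertices. -/
theorem exists_injective_subwalk {α : Type*} {r : α → α → Prop} {w : ℕ → α}
    (hw : ∀ i, r (w i) (w (i + 1))) (hfin : ∀ x, ∀ᶠ i in atTop, w i ≠ x) :
    ∃ φ : ℕ → ℕ, StrictMono φ ∧ Function.Injective (w ∘ φ) ∧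
      ∀ n, r (w (φ n)) (w (φ (n + 1))) := by
  have hlast : ∀ i, ∃ j, i ≤ j ∧ w j = w i ∧ ∀ l, j < l → w l ≠ w i := by
    intro i
    obtain ⟨N, hN⟩ := eventually_atTop.1 (hfin (w i))
    have hbdd : BddAbove {j | w j = w i} := ⟨N, fun j hj => by
      by_contra! hlt
      exact hN j hlt.le hj⟩
    refine ⟨sSup {j | w j = w i}, le_csSup hbdd rfl,
      Nat.sSup_mem (s := {j | w j = w i}) ⟨i, rfl⟩ hbdd, ?_⟩
    exact fun l hl hl' => absurd (le_csSup hbdd hl') (not_le.2 hl)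
  choose g hg hwg hgl using hlast
  obtain ⟨φ, hφ, hstep⟩ := exists_seq_of_forall_exists
    (fun _ j => ∀ l, j < l → w l ≠ w j) (fun _ j j' => j' = g (j + 1))
    ⟨g 0, fun l hl => by rw [hwg]; exact hgl 0 l hl⟩
    (fun _ j _ => ⟨g (j + 1), fun l hl => by rw [hwg]; exact hgl _ l hl, rfl⟩)
  have hmono : StrictMono φ := strictMono_nat_of_lt_succ fun n => by
    rw [hstep]; exact hg _
  refine ⟨φ, hmono, ?_, fun n => by rw [hstep, hwg]; exact hw _⟩
  intro m n hmn
  by_contra hne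
  obtain hlt | hlt := Nat.lt_or_gt_of_ne hne
  · exact hφ m _ (hmono hlt) hmn.symm
  · exact hφ n _ (hmono hlt) hmn

open Filter in
/-- Linking the vertices of a sequence as in `Direction.exists_seq` by finite strongly connected
sets, every vertex lying in only finitely many of them, gives a walk with a tail in every component
chosen by the direction. -/
theorem Direction.exists_walk (c : D.Direction) :
    ∃ w : ℕ → V, (∀ i, D.Adj (w i) (w (i + 1))) ∧ ∀ X, ∀ᶠ i in atTop, w i ∈ c.comp X := by
  classical
  obtain ⟨f, hf⟩ := c.exists_seq
  -- a state `(X, T, v)` consists of a forbidden set, the previous linking set and a vertex of it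
  obtain ⟨s, hs, hstep⟩ := exists_seq_of_forall_exists
    (fun _ (s : Finset V × Finset V × V) => s.2.2 ∈ c.comp s.1 ∧ s.2.2 ∈ s.2.1)
    (fun n s s' => s'.1 = s.1 ∪ s.2.1 ∧ (s'.2.1 : Set V) ⊆ c.comp s.1 ∧ s.2.2 ∈ s'.2.1 ∧
      D.IsStronglyConnectedSet s'.2.1 ∧ ∃ m ≥ n, f m = s'.2.2)
    (by
      obtain ⟨v, hv⟩ := (c.isStrongComp ∅).nonempty
      exact ⟨(∅, {v}, v), hv, by simp⟩)
    (by
      rintro n ⟨X, T, v⟩ ⟨hv, -⟩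
      obtain ⟨m, hm, hmn⟩ := ((hf (X ∪ T)).and (eventually_ge_atTop n)).exists
      have hmX := c.anti _ _ Finset.subset_union_left hm
      obtain ⟨S, hS, hSc, hSs⟩ :=
        (c.isStrongComp X).isStronglyConnectedSet.exists_finset {v, f m} (by
          intro y hy
          obtain rfl | hy := Finset.mem_insert.1 hy
          · exact hv
          · rwa [Finset.mem_singleton.1 hy])
      exact ⟨(X ∪ T, S, f m), ⟨hm, hS (by simp)⟩, rfl, hSc, hS (by simp), hSs, m, hmn, rfl⟩)
  set X : ℕ → Finset V := fun n => (s n).1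
  set T : ℕ → Finset V := fun n => (s n).2.1
  set v : ℕ → V := fun n => (s n).2.2
  have hXm : Monotone X := monotone_nat_of_le_succ fun n => by
    show X n ⊆ X (n + 1)
    rw [show X (n + 1) = X n ∪ T n from (hstep n).1]
    exact Finset.subset_union_left
  have hTX : ∀ n, T n ⊆ X (n + 1) := fun n => by
    rw [show X (n + 1) = X n ∪ T n from (hstep n).1]
    exact Finset.subset_union_right
  have hTc : ∀ n, (T (n + 1) : Set V) ⊆ c.comp (X n) := fun n => (hstep n).2.1
  have hTs : ∀ n, D.IsStronglyConnectedSet (T (n + 1)) := fun n => (hstep n).2.2.2.1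
  have hvT : ∀ n, v n ∈ T (n + 1) := fun n => (hstep n).2.2.1
  have hvT' : ∀ n, v n ∈ T n := fun n => (hs n).2
  have hvne : ∀ n, v n ≠ v (n + 1) := fun n h =>
    c.notMem_of_mem_comp (hTX n) (hs (n + 1)).1 (show v (n + 1) ∈ T n from h ▸ hvT' n)
  obtain ⟨w, hw⟩ := exists_concatenation
    (r := fun n a b => a ∈ T (n + 1) ∧ b ∈ T (n + 1) ∧ D.Adj a b) (v := v) (fun n =>
      (Relation.reflTransGen_iff_eq_or_transGen.1
        (hTs n _ (hvT n) _ (hvT' (n + 1))).2.2).resolve_left (hvne n).symm)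
  have hev : ∀ Y, ∀ᶠ i in atTop, w i ∈ c.comp Y := by
    intro Y
    have havoid : ∀ y : V, ∃ N, ∀ n ≥ N, y ∉ T (n + 1) := by
      intro y
      by_cases hy : ∃ n, y ∈ T n
      · obtain ⟨n, hn⟩ := hy
        exact ⟨n + 1, fun m hm hym =>
          c.notMem_of_mem_comp subset_rfl (hTc m hym) (hXm hm (hTX n hn))⟩
      · push Not at hy
        exact ⟨0, fun n _ => hy _⟩
    choose N hN using havoid
    obtain ⟨M, hM⟩ := eventually_atTop.1 (hf Y)
    filter_upwards [hw (max M (Y.sup N))] with i ⟨n, hn, hi, _⟩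
    obtain ⟨m, hm, hmv⟩ := (hstep n).2.2.2.2
    refine c.subset_of_strong (hTs n) (fun x hx hxY => ?_) (hvT' (n + 1)) ?_ hi
    · exact hN x n ((Finset.le_sup hxY).trans ((le_max_right _ _).trans hn)) hx
    · have := hM m (((le_max_left _ _).trans hn).trans hm)
      rwa [hmv] at this
  obtain ⟨i₀, hi₀⟩ := eventually_atTop.1 (hw 0)
  refine ⟨fun i => w (i + i₀), fun i => ?_, fun Y => (tendsto_add_atTop_nat i₀).eventually (hev Y)⟩
  obtain ⟨n, -, -, -, h⟩ := hi₀ (i + i₀) (by omega)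
  change D.Adj (w (i + i₀)) (w (i + 1 + i₀))
  rwa [Nat.add_right_comm]

theorem SolidRay.comp_eq (R : D.SolidRay) {X : Finset V} {C : Set V}
    (hC : D.IsStrongComp (X : Set V)ᶜ C) (h : HasTailIn R.toFun C) : R.comp X = C := by
  ext v
  constructor
  · rintro ⟨C', hC', h', hv⟩
    rwa [HasTailIn.eq hC hC' h h']
  · exact fun hv => ⟨C, hC, h, hv⟩

/-- Every direction is given by an end. -/
theorem Direction.exists_end (c : D.Direction) : ∃ ω : D.Ends, ∀ X, ω.comp X = c.comp X := by
  obtain ⟨w, hadj, hw⟩ := c.exists_walk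
  obtain ⟨φ, hφ, hinj, hstep⟩ := exists_injective_subwalk (r := D.Adj) hadj (fun x => by
    filter_upwards [hw {x}] with i hi
    simpa using c.notMem_of_mem_comp subset_rfl hi)
  have htail : ∀ X, HasTailIn (w ∘ φ) (c.comp X) := fun X =>
    Filter.eventually_atTop.1 (hφ.tendsto_atTop.eventually (hw X))
  let R : D.SolidRay := ⟨w ∘ φ, hinj, hstep, fun X => ⟨_, c.isStrongComp X, htail X⟩⟩
  exact ⟨Quotient.mk _ R, fun X => R.comp_eq (c.isStrongComp X) (htail X)⟩

/-! ### Ends and the components in which they live -/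

theorem Ends.isStrongComp_comp (ω : D.Ends) (X : Finset V) :
    D.IsStrongComp (X : Set V)ᶜ (ω.comp X) := by
  induction ω using Quotient.inductionOn with
  | h R =>
    obtain ⟨C, hC, h⟩ := R.solid X
    change D.IsStrongComp _ (R.comp X)
    rwa [R.comp_eq hC h]

theorem SolidRay.hasTailIn_comp (R : D.SolidRay) (X : Finset V) :
    HasTailIn R.toFun (R.comp X) := by
  obtain ⟨C, hC, h⟩ := R.solid X
  rwa [R.comp_eq hC h]

/-- Ends that live in the same strong components are equal. -/
theorem Ends.ext {ω η : D.Ends} (h : ∀ X, ω.comp X = η.comp X) : ω = η := by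
  induction ω using Quotient.inductionOn with
  | h R =>
    induction η using Quotient.inductionOn with
    | h R' =>
      refine Quotient.sound fun X => ⟨R.comp X, Ends.isStrongComp_comp (Quotient.mk _ R) X,
        R.hasTailIn_comp X, ?_⟩
      have := R'.hasTailIn_comp X
      rwa [← show R.comp X = R'.comp X from h X] at this

theorem Ends.comp_anti (ω : D.Ends) {X Y : Finset V} (h : X ⊆ Y) : ω.comp Y ⊆ ω.comp X := by
  induction ω using Quotient.inductionOn with
  | h R =>
    obtain ⟨m, hm⟩ := R.hasTailIn_comp X
    obtain ⟨n, hn⟩ := R.hasTailIn_comp Y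
    exact (Ends.isStrongComp_comp (Quotient.mk _ R) X).subset_of_mem
      (Ends.isStrongComp_comp (Quotient.mk _ R) Y) (by simpa using h)
      (hm _ (le_max_left m n)) (hn _ (le_max_right m n))

theorem Node.SameSide.liesIn {X : Finset V} {C : Set V} {x y : D.Node}
    (h : Node.SameSide X x y) (hx : Node.LiesIn X C x) : Node.LiesIn X C y := by
  cases x with
  | inl v => exact (show y = .inl v from h) ▸ hx
  | inr ω =>
    obtain rfl : ω.comp X = C := hx
    exact h

theorem Node.SameSide.trans {X : Finset V} {x y z : D.Node}
    (h : Node.SameSide X x y) (h' : Node.SameSide X y z) : Node.SameSide X x z := by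
  cases x with
  | inl v =>
    obtain rfl : y = .inl v := h
    exact h'
  | inr ω => exact Node.SameSide.liesIn h' h

/-! ### Edges between components -/

theorem Edge.exists_adj_of_tail (e : D.Edge) {X : Finset V} {C : Set V} {v : V}
    (ht : e.tail = .inl v) (hh : Node.LiesIn X C e.head) (hv : v ∉ C) :
    ∃ b ∈ C, D.Adj v b := by
  obtain ⟨x, y, he⟩ := e
  obtain rfl : x = .inl v := ht
  cases y with
  | inl w => exact ⟨w, hh, he⟩
  | inr η =>
    obtain rfl : η.comp X = C := hh
    exact he X hv

theorem Edge.exists_adj_of_head (e : D.Edge) {X : Finset V} {C : Set V} {v : V}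
    (hh : e.head = .inl v) (ht : Node.LiesIn X C e.tail) (hv : v ∉ C) :
    ∃ a ∈ C, D.Adj a v := by
  obtain ⟨x, y, he⟩ := e
  obtain rfl : y = .inl v := hh
  cases x with
  | inl w => exact ⟨w, ht, he⟩
  | inr η =>
    obtain rfl : η.comp X = C := ht
    exact he X hv

/-- Any edge of `|D|` between two strong components of `D - X`, whether an edge of `D` or a limit edge,
yields an edge of `D` between them. -/
theorem Edge.exists_adj (e : D.Edge) {X : Finset V} {C C' : Set V}
    (hC : D.IsStrongComp (X : Set V)ᶜ C) (hC' : D.IsStrongComp (X : Set V)ᶜ C') (hne : C ≠ C')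
    (ht : Node.LiesIn X C e.tail) (hh : Node.LiesIn X C' e.head) :
    ∃ a ∈ C, ∃ b ∈ C', D.Adj a b := by
  have hdisj : ∀ v ∈ C, v ∉ C' := fun v hv hv' => hne (hC.eq_of_mem hC' hv hv')
  obtain ⟨x, y, he⟩ := e
  cases x with
  | inl v => exact ⟨v, ht, Edge.exists_adj_of_tail ⟨_, y, he⟩ rfl hh (hdisj v ht)⟩
  | inr ω =>
    cases y with
    | inl w =>
      obtain ⟨a, ha, h⟩ :=
        Edge.exists_adj_of_head ⟨_, _, he⟩ rfl ht fun hw => hdisj w hw hh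
      exact ⟨a, ha, w, hh, h⟩
    | inr η =>
      obtain rfl : ω.comp X = C := ht
      obtain rfl : η.comp X = C' := hh
      exact he.2 X hne

/-! ### Closed discrete vertex sets -/

theorem Space.isOpen_of_isBasicOpen {s : Set D.Space} (hs : Space.IsBasicOpen s) : IsOpen s :=
  TopologicalSpace.isOpen_generateFrom_of_mem hs

open Set in
/-- A vertex set meeting every strong component of some `D - X` at most once is closed: deleting one
further vertex separates it from a given end. -/
theorem Space.isClosed_of_subsingleton {X : Finset V} {U : Set V}
    (hU : ∀ C, D.IsStrongComp (X : Set V)ᶜ C → (U ∩ C).Subsingleton) :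
    IsClosed ((Space.vertex : V → D.Space) '' U) := by
  classical
  rw [← isOpen_compl_iff, isOpen_iff_forall_mem_open]
  have hinner : ∀ (e : D.Edge) (t : Ioo (0 : ℝ) 1) (Y : Finset V), Node.Admits Y e.tail e.head →
      ∃ s ⊆ (Space.vertex '' U)ᶜ, IsOpen s ∧ Space.inner e t ∈ s := by
    intro e t Y hY
    have ht := t.2
    refine ⟨Space.edgeNhd Y e t (min t (1 - t)), ?_, Space.isOpen_of_isBasicOpen
      (.edgeNhd Y e hY t _ (lt_min ht.1 (by linarith [ht.2])) (min_le_left _ _)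
        (min_le_right _ _)), ?_⟩
    · rintro _ h ⟨u, -, rfl⟩
      exact h
    · have hside : ∀ x : D.Node, Node.SameSide Y x x := fun x => by
        cases x <;> rfl
      exact ⟨hside _, hside _, by simpa using ⟨ht.1, ht.2⟩⟩
  intro p hp
  rcases p with (v | ω) | ⟨e, t⟩
  · refine ⟨Space.star v 1, ?_, Space.isOpen_of_isBasicOpen (.star v 1 one_pos le_rfl), rfl⟩
    rintro _ h ⟨u, hu, rfl⟩
    exact hp ⟨u, hu, congrArg Space.node h⟩
  · let Y : Finset V := X ∪ (hU _ (ω.isStrongComp_comp X)).finite.toFinset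
    refine ⟨Space.endNhd Y ω 1, ?_,
      Space.isOpen_of_isBasicOpen (.endNhd Y ω 1 one_pos le_rfl), rfl⟩
    rintro _ h ⟨u, hu, rfl⟩
    have huY : u ∈ ω.comp Y := h
    have huX : u ∈ ω.comp X := ω.comp_anti Finset.subset_union_left huY
    exact (ω.isStrongComp_comp Y).subset huY
      (Finset.mem_union_right _ (by simpa using ⟨hu, huX⟩))
  · obtain ⟨x, y, he⟩ := e
    rcases x with v | ω
    · rcases y with w | η
      · exact hinner _ t ∅ trivial
      · exact hinner _ t {v} (Finset.mem_singleton_self v)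
    · rcases y with w | η
      · exact hinner _ t {w} (Finset.mem_singleton_self w)
      · obtain ⟨Y, hY⟩ : ∃ Y, ω.comp Y ≠ η.comp Y := by
          by_contra! h
          exact he.1 (Ends.ext h)
        exact hinner _ t Y hY

/-- Closed vertex sets in a compact `|D|` are finite, since the stars around their vertices
show that they are discrete. -/
theorem Space.finite_of_isClosed [CompactSpace D.Space] {U : Set V}
    (hU : IsClosed ((Space.vertex : V → D.Space) '' U)) : U.Finite := by
  obtain ⟨T, hT⟩ := hU.isCompact.elim_finite_subcover (fun v : V => Space.star v 1)
    (fun v => Space.isOpen_of_isBasicOpen (.star v 1 one_pos le_rfl)) (by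
      rintro _ ⟨u, -, rfl⟩
      exact Set.mem_iUnion.2 ⟨u, rfl⟩)
  refine T.finite_toSet.subset fun u hu => ?_
  obtain ⟨v, hv, huv⟩ := Set.mem_iUnion₂.1 (hT ⟨u, hu, rfl⟩)
  have : (Sum.inl u : D.Node) = .inl v := huv
  rwa [Sum.inl_injective this]

/-! ### Compactness for solid digraphs -/

open Filter Topology

/-- In a solid digraph, an ultrafilter on vertices and ends that is not principal at a vertex picks
one strong component of each `D - X`, and hence a direction. -/
theorem IsSolid.exists_direction (hD : D.IsSolid) (F : Ultrafilter D.Node)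
    (hF : ∀ v, ∀ᶠ x in (F : Filter D.Node), x ≠ .inl v) :
    ∃ c : D.Direction, ∀ X, ∀ᶠ x in (F : Filter D.Node), Node.LiesIn X (c.comp X) x := by
  have hex : ∀ X : Finset V, ∃ C, D.IsStrongComp (X : Set V)ᶜ C ∧
      ∀ᶠ x in (F : Filter D.Node), Node.LiesIn X C x := by
    intro X
    refine (Ultrafilter.finite_biUnion_mem_iff (hD X)
      (s := fun C => {x : D.Node | Node.LiesIn X C x})).1 ?_
    have hX : ∀ᶠ x in (F : Filter D.Node), ∀ v ∈ X, x ≠ .inl v :=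
      (Filter.eventually_all_finset X).2 fun v _ => hF v
    filter_upwards [hX] with x hx
    cases x with
    | inl v =>
      have hv : v ∈ (X : Set V)ᶜ := fun hv => hx v hv rfl
      exact Set.mem_biUnion (isStrongComp_strongComp hv)
        (show v ∈ D.strongComp _ v from mem_strongComp_self hv)
    | inr ω =>
      exact Set.mem_biUnion (ω.isStrongComp_comp X)
        (show Node.LiesIn X _ (Sum.inr ω) from rfl)
  choose c hc hcF using hex
  refine ⟨⟨c, hc, fun X Y hXY => ?_⟩, hcF⟩
  obtain ⟨x, hx, hy⟩ := ((hcF X).and (hcF Y)).exists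
  have hsub : (Y : Set V)ᶜ ⊆ (X : Set V)ᶜ := by simpa using hXY
  cases x with
  | inl v => exact (hc X).subset_of_mem (hc Y) hsub hx hy
  | inr ω =>
    have hx : ω.comp X = c X := hx
    have hy : ω.comp Y = c Y := hy
    rw [← hx, ← hy]
    exact ω.comp_anti hXY

/-- In a solid digraph, every ultrafilter on the set of vertices and ends has a limit. -/
theorem IsSolid.exists_limit (hD : D.IsSolid) (F : Ultrafilter D.Node) :
    ∃ x : D.Node, ∀ X, ∀ᶠ y in (F : Filter D.Node), Node.SameSide X x y := by
  by_cases h : ∃ v, ∀ᶠ x in (F : Filter D.Node), x = .inl v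
  · obtain ⟨v, hv⟩ := h
    exact ⟨.inl v, fun X => hv⟩
  · push Not at h
    obtain ⟨c, hc⟩ := hD.exists_direction F h
    obtain ⟨ω, hω⟩ := c.exists_end
    exact ⟨.inr ω, fun X => by
      simpa only [Node.SameSide, hω] using hc X⟩

/-- The pair of the limits of the tails and of the heads of edges is itself an edge of `|D|`. -/
theorem isEdge_of_eventually {ι : Type*} {F : Filter ι} [F.NeBot] {e : ι → D.Edge}
    {x y : D.Node} (hx : ∀ X, ∀ᶠ i in F, Node.SameSide X x (e i).tail)
    (hy : ∀ X, ∀ᶠ i in F, Node.SameSide X y (e i).head) (hxy : x ≠ y) : D.IsEdge x y := by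
  rcases x with v | ω
  · rcases y with w | η
    · obtain ⟨i, hi, hi'⟩ := ((hx ∅).and (hy ∅)).exists
      have h1 : (e i).tail = .inl v := hi
      have h2 : (e i).head = .inl w := hi'
      have := (e i).isEdge
      rwa [h1, h2] at this
    · intro X hX
      obtain ⟨i, hi, hi'⟩ := ((hx X).and (hy X)).exists
      exact (e i).exists_adj_of_tail hi hi' hX
  · rcases y with w | η
    · intro X hX
      obtain ⟨i, hi, hi'⟩ := ((hx X).and (hy X)).exists
      exact (e i).exists_adj_of_head hi' hi hX
    · refine ⟨fun h => hxy (h ▸ rfl), fun X hX => ?_⟩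
      obtain ⟨i, hi, hi'⟩ := ((hx X).and (hy X)).exists
      exact (e i).exists_adj (ω.isStrongComp_comp X) (η.isStrongComp_comp X) hX hi hi'

theorem Space.tendsto_nhds_iff {ι : Type*} {F : Filter ι} {g : ι → D.Space} {p : D.Space} :
    Tendsto g F (𝓝 p) ↔ ∀ s, Space.IsBasicOpen s → p ∈ s → ∀ᶠ i in F, g i ∈ s :=
  TopologicalSpace.tendsto_nhds_generateFrom_iff

/-- Only stars and neighbourhoods of ends contain vertices or ends, so only these matter for
convergence to such points. -/
theorem Space.tendsto_nhds_node {ι : Type*} {F : Filter ι} {g : ι → D.Space} {x : D.Node}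
    (hstar : ∀ v ε, 0 < ε → x = .inl v → ∀ᶠ i in F, g i ∈ Space.star v ε)
    (hend : ∀ X ω ε, 0 < ε → Node.LiesIn X (ω.comp X) x →
      ∀ᶠ i in F, g i ∈ Space.endNhd X ω ε) :
    Tendsto g F (𝓝 (Space.node x)) := by
  rw [Space.tendsto_nhds_iff]
  intro s hs hp
  cases hs with
  | star v ε hε => exact hstar v ε hε hp
  | endNhd X ω ε hε => exact hend X ω ε hε hp
  | edgeNhd => exact hp.elim

/-- In the `|D|` of a solid digraph, inner points `inner (e i) (t i)` have a limit along every
ultrafilter. If `x`, `y` and `s` are the limits of the tails, the heads and the positions, this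
limit is `x` if `s = 0`, it is `y` if `s = 1`, it is `x` if `x = y` is an end, and otherwise it is
the point of the edge `(x, y)` at `s`. -/
theorem IsSolid.exists_tendsto_inner (hD : D.IsSolid) (hloop : ∀ v, ¬ D.Adj v v) {ι : Type*}
    (F : Ultrafilter ι) (e : ι → D.Edge) (t : ι → Set.Ioo (0 : ℝ) 1) :
    ∃ p : D.Space, Tendsto (fun i => Space.inner (e i) (t i)) F (𝓝 p) := by
  obtain ⟨x, hx⟩ := hD.exists_limit (F.map fun i => (e i).tail)
  obtain ⟨y, hy⟩ := hD.exists_limit (F.map fun i => (e i).head)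
  replace hx : ∀ X, ∀ᶠ i in F, Node.SameSide X x (e i).tail := hx
  replace hy : ∀ X, ∀ᶠ i in F, Node.SameSide X y (e i).head := hy
  obtain ⟨s, hs, hts⟩ := (isCompact_Icc (a := (0 : ℝ)) (b := 1)).ultrafilter_le_nhds
    (F.map fun i => (t i : ℝ)) (by
      rw [le_principal_iff]
      exact Filter.mem_map.2 (Eventually.of_forall fun i => ⟨(t i).2.1.le, (t i).2.2.le⟩))
  replace hts : Tendsto (fun i => (t i : ℝ)) F (𝓝 s) := hts
  obtain rfl | hs0 := hs.1.eq_or_lt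
  · refine ⟨.node x, Space.tendsto_nhds_node (fun v ε hε hv => ?_) (fun X ω ε hε hω => ?_)⟩
    · subst hv
      filter_upwards [hx ∅, hts.eventually_lt_const hε] with i h1 h2
      exact .inl ⟨h1, h2⟩
    · filter_upwards [hx X, hts.eventually_lt_const hε] with i h1 h2
      exact .inr (.inl ⟨h1.liesIn hω, h2⟩)
  obtain rfl | hs1 := hs.2.eq_or_lt
  · refine ⟨.node y, Space.tendsto_nhds_node (fun v ε hε hv => ?_) (fun X ω ε hε hω => ?_)⟩
    · subst hv
      filter_upwards [hy ∅, hts.eventually_const_lt (sub_lt_self 1 hε)] with i h1 h2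
      exact .inr ⟨h1, h2⟩
    · filter_upwards [hy X, hts.eventually_const_lt (sub_lt_self 1 hε)] with i h1 h2
      exact .inr (.inr ⟨h1.liesIn hω, h2⟩)
  by_cases hxy : x = y
  · subst hxy
    refine ⟨.node x, Space.tendsto_nhds_node (fun v ε hε hv => ?_) (fun X ω ε hε hω => ?_)⟩
    · subst hv
      obtain ⟨i, h1, h2⟩ := ((hx ∅).and (hy ∅)).exists
      have h1 : (e i).tail = .inl v := h1
      have h2 : (e i).head = .inl v := h2
      have := (e i).isEdge
      rw [h1, h2] at this
      exact (hloop v this).elim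
    · filter_upwards [hx X, hy X] with i h1 h2
      exact .inl ⟨h1.liesIn hω, h2.liesIn hω⟩
  · refine ⟨.inner ⟨x, y, isEdge_of_eventually hx hy hxy⟩ ⟨s, hs0, hs1⟩, ?_⟩
    rw [Space.tendsto_nhds_iff]
    intro S hS hp
    cases hS with
    | star v ε hε =>
      obtain ⟨h1, h2⟩ | ⟨h1, h2⟩ := hp
      · obtain rfl : x = .inl v := h1
        filter_upwards [hx ∅, hts.eventually_lt_const h2] with i h3 h4
        exact .inl ⟨h3, h4⟩
      · obtain rfl : y = .inl v := h1
        filter_upwards [hy ∅, hts.eventually_const_lt h2] with i h3 h4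
        exact .inr ⟨h3, h4⟩
    | endNhd X ω ε hε =>
      obtain ⟨h1, h2⟩ | ⟨h1, h2⟩ | ⟨h1, h2⟩ := hp
      · filter_upwards [hx X, hy X] with i h3 h4
        exact .inl ⟨h3.liesIn h1, h4.liesIn h2⟩
      · filter_upwards [hx X, hts.eventually_lt_const h2] with i h3 h4
        exact .inr (.inl ⟨h3.liesIn h1, h4⟩)
      · filter_upwards [hy X, hts.eventually_const_lt h2] with i h3 h4
        exact .inr (.inr ⟨h3.liesIn h1, h4⟩)
    | edgeNhd X f _ t₀ ε =>
      obtain ⟨h1, h2, h3⟩ := hp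
      filter_upwards [hx X, hy X, (hts.sub_const (t₀ : ℝ)).abs.eventually_lt_const h3]
        with i h4 h5 h6
      exact ⟨h1.trans h4, h2.trans h5, h6⟩

theorem IsSolid.compactSpace (hD : D.IsSolid) (hloop : ∀ v, ¬ D.Adj v v) :
    CompactSpace D.Space := by
  refine ⟨isCompact_iff_ultrafilter_le_nhds.2 fun F _ => ?_⟩
  suffices h : ∃ p, (F : Filter D.Space) ≤ 𝓝 p by simpa using h
  obtain hn | hi : (∀ᶠ p in (F : Filter D.Space), ∃ x, Space.node x = p) ∨
      ∀ᶠ p in (F : Filter D.Space), ∃ q : D.Edge × Set.Ioo (0 : ℝ) 1, Space.inner q.1 q.2 = p := by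
    rw [← Ultrafilter.eventually_or]
    refine Eventually.of_forall fun p => ?_
    cases p with
    | node x => exact .inl ⟨x, rfl⟩
    | inner e t => exact .inr ⟨(e, t), rfl⟩
  · obtain ⟨G, hG⟩ : ∃ G : Ultrafilter D.Node, G.map Space.node = F :=
      ⟨_, Ultrafilter.ofComapInfPrincipal_eq_of_map (s := Set.univ) (by
        rw [Set.image_univ]; exact hn)⟩
    obtain ⟨x, hx⟩ := hD.exists_limit G
    refine ⟨.node x, hG ▸ Space.tendsto_nhds_node (fun v ε hε hv => ?_) (fun X ω ε hε hω => ?_)⟩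
    · subst hv
      exact hx ∅
    · exact (hx X).mono fun y hy => hy.liesIn hω
  · obtain ⟨G, hG⟩ : ∃ G : Ultrafilter (D.Edge × Set.Ioo (0 : ℝ) 1),
        G.map (fun q => Space.inner q.1 q.2) = F :=
      ⟨_, Ultrafilter.ofComapInfPrincipal_eq_of_map (s := Set.univ) (by
        rw [Set.image_univ]; exact hi)⟩
    obtain ⟨p, hp⟩ := hD.exists_tendsto_inner hloop G (fun q => q.1) fun q => q.2
    exact ⟨p, hG ▸ hp⟩

/-! ### Paths as lists -/

theorem reachIn_of_isChain {T : Set V} {l : List V} : ∀ {a : V},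
    List.IsChain D.Adj (a :: l) → (∀ w ∈ a :: l, w ∈ T) → ∀ w ∈ a :: l, D.ReachIn T a w := by
  induction l with
  | nil =>
    intro a _ hT w hw
    obtain rfl := List.mem_singleton.1 hw
    exact .refl (hT _ hw)
  | cons b l ih =>
    intro a h hT w hw
    rw [List.isChain_cons_cons] at h
    have ha := hT a (by simp)
    obtain rfl | hw := List.mem_cons.1 hw
    · exact .refl ha
    · exact (ReachIn.single ha (hT b (by simp)) h.1).trans
        (ih h.2 (fun x hx => hT x (List.mem_cons_of_mem _ hx)) w hw)

theorem reachIn_last_of_isChain {T : Set V} {l : List V} {a b : V}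
    (h : List.IsChain D.Adj (a :: (l ++ [b]))) (hT : ∀ w ∈ l, w ∈ T) (hb : b ∈ T) {w : V}
    (hw : w ∈ l) : D.ReachIn T w b := by
  obtain ⟨l₁, l₂, rfl⟩ := List.append_of_mem hw
  rw [show a :: (l₁ ++ w :: l₂ ++ [b]) = (a :: l₁) ++ w :: (l₂ ++ [b]) by simp,
    List.isChain_split] at h
  refine reachIn_of_isChain h.2 (fun x hx => ?_) b (by simp)
  simp only [List.mem_cons, List.mem_append, List.not_mem_nil, or_false] at hx
  obtain rfl | hx | rfl := hx
  · exact hT _ hw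
  · exact hT _ (by simp [hx])
  · exact hb

theorem exists_append_of_not_nodup {α : Type*} {l : List α} (h : ¬ l.Nodup) :
    ∃ w l₁ l₂ l₃, l = l₁ ++ w :: (l₂ ++ w :: l₃) := by
  induction l with
  | nil => exact absurd List.nodup_nil h
  | cons x l ih =>
    by_cases hx : x ∈ l
    · obtain ⟨l₂, l₃, rfl⟩ := List.append_of_mem hx
      exact ⟨x, [], l₂, l₃, rfl⟩
    · obtain ⟨w, l₁, l₂, l₃, rfl⟩ := ih fun hl => h (List.nodup_cons.2 ⟨hx, hl⟩)
      exact ⟨w, x :: l₁, l₂, l₃, rfl⟩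

/-- A walk from `A` to `B` can be shortened to a path whose inner vertices avoid `A ∪ B`. -/
theorem exists_path_of_isChain {α : Type*} {r : α → α → Prop} {A B : Set α} (n : ℕ) :
    ∀ (l : List α) (a b : α), l.length = n → a ∈ A → b ∈ B → List.IsChain r (a :: (l ++ [b])) →
      ∃ a ∈ A, ∃ b ∈ B, ∃ l : List α, List.IsChain r (a :: (l ++ [b])) ∧ l.Nodup ∧
        ∀ w ∈ l, w ∉ A ∧ w ∉ B := by
  induction n using Nat.strong_induction_on with
  | _ n ih =>
    intro l a b hn ha hb hl
    by_cases hA : ∃ w ∈ l, w ∈ A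
    · obtain ⟨w, hw, hwA⟩ := hA
      obtain ⟨l₁, l₂, rfl⟩ := List.append_of_mem hw
      rw [show a :: (l₁ ++ w :: l₂ ++ [b]) = (a :: l₁) ++ w :: (l₂ ++ [b]) by simp,
        List.isChain_split] at hl
      simp only [List.length_append, List.length_cons] at hn
      exact ih _ (by omega) l₂ w b rfl hwA hb hl.2
    by_cases hB : ∃ w ∈ l, w ∈ B
    · obtain ⟨w, hw, hwB⟩ := hB
      obtain ⟨l₁, l₂, rfl⟩ := List.append_of_mem hw
      rw [show a :: (l₁ ++ w :: l₂ ++ [b]) = (a :: l₁) ++ w :: (l₂ ++ [b]) by simp,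
        List.isChain_split] at hl
      simp only [List.length_append, List.length_cons] at hn
      exact ih _ (by omega) l₁ a w rfl ha hwB hl.1
    by_cases hnd : l.Nodup
    · push Not at hA hB
      exact ⟨a, ha, b, hb, l, hl, hnd, fun w hw => ⟨hA w hw, hB w hw⟩⟩
    · obtain ⟨w, l₁, l₂, l₃, rfl⟩ := exists_append_of_not_nodup hnd
      rw [show a :: (l₁ ++ w :: (l₂ ++ w :: l₃) ++ [b]) =
        (a :: l₁) ++ w :: ((l₂ ++ w :: l₃) ++ [b]) by simp, List.isChain_split] at hl
      obtain ⟨hl₁, hl₂⟩ := hl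
      rw [show w :: ((l₂ ++ w :: l₃) ++ [b]) = (w :: l₂) ++ w :: (l₃ ++ [b]) by simp,
        List.isChain_split] at hl₂
      simp only [List.length_append, List.length_cons] at hn
      refine ih _ ?_ (l₁ ++ w :: l₃) a b rfl ha hb ?_
      · simp only [List.length_append, List.length_cons]
        omega
      · rw [show a :: (l₁ ++ w :: l₃ ++ [b]) = (a :: l₁) ++ w :: (l₃ ++ [b]) by simp,
          List.isChain_split]
        exact ⟨hl₁, hl₂.2⟩

theorem ReachIn.exists_path {S A B : Set V} {a b : V} (h : D.ReachIn S a b) (ha : a ∈ A)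
    (hb : b ∈ B) (hAB : Disjoint A B) :
    ∃ a ∈ A, ∃ b ∈ B, ∃ l : List V, List.IsChain D.Adj (a :: (l ++ [b])) ∧ l.Nodup ∧
      ∀ w ∈ l, w ∈ S ∧ w ∉ A ∧ w ∉ B := by
  obtain ⟨-, -, h⟩ := h
  obtain h | h := Relation.reflTransGen_iff_eq_or_transGen.1 h
  · exact absurd (h ▸ hb) (Set.disjoint_left.1 hAB ha)
  obtain ⟨c, hac, hcb⟩ := Relation.TransGen.tail'_iff.1 h
  obtain ⟨m, hm, hlast⟩ := List.exists_isChain_cons_of_relationReflTransGen hac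
  have hchain : List.IsChain (fun a b => a ∈ S ∧ b ∈ S ∧ D.Adj a b) (a :: (m ++ [b])) := by
    rw [← List.cons_append, List.isChain_append]
    refine ⟨hm, List.isChain_singleton _, fun x hx y hy => ?_⟩
    rw [List.getLast?_eq_some_getLast (List.cons_ne_nil _ _), hlast, Option.mem_some] at hx
    obtain rfl := hx
    obtain rfl : b = y := by simpa using hy
    exact hcb
  obtain ⟨a', ha', b', hb', l, hl, hnd, hav⟩ := exists_path_of_isChain _ m a b rfl ha hb hchain
  refine ⟨a', ha', b', hb', l, hl.imp fun _ _ h => h.2.2, hnd, fun w hw => ⟨?_, hav w hw⟩⟩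
  obtain ⟨l₁, l₂, rfl⟩ := List.append_of_mem hw
  rw [show a' :: (l₁ ++ w :: l₂ ++ [b']) = (a' :: l₁) ++ w :: (l₂ ++ [b']) by simp,
    List.isChain_split] at hl
  obtain ⟨x, hx⟩ : ∃ x m, l₂ ++ [b'] = x :: m := by cases l₂ <;> simp
  obtain ⟨m, hm⟩ := hx
  rw [hm, List.isChain_cons_cons] at hl
  exact hl.2.1.1

/-! ### Necklaces -/

/-- One step in the construction of a necklace along a direction. Given a bead `B` in `C(X)`, put
`K = C(X ∪ B)`, and take paths from `B` to `K` and back inside `C(X)`. They are internally disjoint,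
as a common inner vertex would lie on a closed walk through `K` avoiding `X ∪ B`, and so would
lie in `K`. The next bead is a finite strongly connected subset of `K` containing the ends of
these paths and a given vertex `u`. -/
theorem Direction.exists_bead [DecidableEq V] (c : D.Direction) {X B : Finset V}
    (hB : B.Nonempty) (hBX : (B : Set V) ⊆ c.comp X) {u : V} (hu : u ∈ c.comp (X ∪ B)) :
    ∃ (B' : Finset V) (p q : List V), u ∈ B' ∧ (B' : Set V) ⊆ c.comp (X ∪ B) ∧
      D.IsStronglyConnectedSet B' ∧
      (∃ a ∈ B, ∃ b ∈ B', List.IsChain D.Adj (a :: (p ++ [b]))) ∧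
      (∃ a ∈ B', ∃ b ∈ B, List.IsChain D.Adj (a :: (q ++ [b]))) ∧
      p.Nodup ∧ q.Nodup ∧ p.Disjoint q ∧
      (∀ w ∈ p, w ∈ c.comp X ∧ w ∉ B ∧ w ∉ c.comp (X ∪ B)) ∧
      ∀ w ∈ q, w ∈ c.comp X ∧ w ∉ B ∧ w ∉ c.comp (X ∪ B) := by
  have hK := c.isStrongComp (X ∪ B)
  have hKX : c.comp (X ∪ B) ⊆ c.comp X := c.anti _ _ Finset.subset_union_left
  have hdisj : Disjoint (B : Set V) (c.comp (X ∪ B)) := Set.disjoint_left.2 fun v hv hv' =>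
    c.notMem_of_mem_comp Finset.subset_union_right hv' hv
  have hstr := (c.isStrongComp X).isStronglyConnectedSet
  obtain ⟨b₀, hb₀⟩ := hB
  obtain ⟨a₁, ha₁, k₁, hk₁, p, hp, hpnd, hpav⟩ :=
    (hstr b₀ (hBX hb₀) u (hKX hu)).exists_path (A := B) hb₀ hu hdisj
  obtain ⟨k₂, hk₂, a₂, ha₂, q, hq, hqnd, hqav⟩ :=
    (hstr u (hKX hu) b₀ (hBX hb₀)).exists_path (B := B) hu hb₀ hdisj.symm
  obtain ⟨B', hB', hB'K, hB's⟩ := hK.isStronglyConnectedSet.exists_finset {u, k₁, k₂} (by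
    intro x hx
    simp only [Finset.coe_insert, Finset.coe_singleton, Set.mem_insert_iff,
      Set.mem_singleton_iff] at hx
    obtain rfl | rfl | rfl := hx
    exacts [hu, hk₁, hk₂])
  have hout : ∀ w ∈ c.comp X, w ∉ B → w ∈ ((X ∪ B : Finset V) : Set V)ᶜ := by
    intro w hw hwB hw'
    obtain hw' | hw' := Finset.mem_union.1 hw'
    · exact c.notMem_of_mem_comp subset_rfl hw hw'
    · exact hwB hw'
  refine ⟨B', p, q, hB' (by simp), hB'K, hB's, ⟨a₁, ha₁, k₁, hB' (by simp), hp⟩,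
    ⟨k₂, hB' (by simp), a₂, ha₂, hq⟩, hpnd, hqnd, fun w hwp hwq => ?_, hpav,
    fun w hw => ⟨(hqav w hw).1, (hqav w hw).2.2, (hqav w hw).2.1⟩⟩
  have hwk₁ := reachIn_last_of_isChain hp
    (fun x hx => hout x (hpav x hx).1 (hpav x hx).2.1) (hK.subset hk₁) hwp
  have hk₂w : D.ReachIn ((X ∪ B : Finset V) : Set V)ᶜ k₂ w := by
    have hq' : List.IsChain D.Adj (k₂ :: q) := by
      rw [← List.cons_append] at hq
      exact hq.left_of_append
    refine reachIn_of_isChain hq' (fun x hx => ?_) w (List.mem_cons_of_mem _ hwq)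
    obtain rfl | hx := List.mem_cons.1 hx
    · exact hK.subset hk₂
    · exact hout x (hqav x hx).1 (hqav x hx).2.2
  exact (hpav w hwp).2.2 (hK.mem_of_reach hk₂ hk₁ hk₂w hwk₁)

/-- If every component chosen by a direction meets `U`, there is a necklace attached to `U`. -/
theorem Direction.exists_necklace (c : D.Direction) {U : Set V}
    (hU : ∀ X, ∃ u ∈ U, u ∈ c.comp X) : ∃ N : D.Necklace, N.IsAttachedTo U := by
  classical
  obtain ⟨s, hs, hstep⟩ := exists_seq_of_forall_exists
    (fun _ (s : Finset V × Finset V) => (∃ u ∈ s.2, u ∈ U) ∧ (s.2 : Set V) ⊆ c.comp s.1 ∧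
      D.IsStronglyConnectedSet s.2)
    (fun _ s s' => s'.1 = s.1 ∪ s.2 ∧ ∃ p q : List V,
      (∃ a ∈ s.2, ∃ b ∈ s'.2, List.IsChain D.Adj (a :: (p ++ [b]))) ∧
      (∃ a ∈ s'.2, ∃ b ∈ s.2, List.IsChain D.Adj (a :: (q ++ [b]))) ∧
      p.Nodup ∧ q.Nodup ∧ p.Disjoint q ∧
      (∀ w ∈ p, w ∈ c.comp s.1 ∧ w ∉ s.2 ∧ w ∉ c.comp s'.1) ∧
      ∀ w ∈ q, w ∈ c.comp s.1 ∧ w ∉ s.2 ∧ w ∉ c.comp s'.1)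
    (by
      obtain ⟨u, hu, huc⟩ := hU ∅
      refine ⟨(∅, {u}), ⟨u, by simp, hu⟩, by simpa using huc,
        isStronglyConnectedSet_of_center u fun w hw => ?_⟩
      obtain rfl := Finset.mem_singleton.1 hw
      exact ⟨.refl hw, .refl hw⟩)
    (by
      rintro n ⟨X, B⟩ ⟨⟨v, hv, -⟩, hBX, -⟩
      obtain ⟨u, hu, huc⟩ := hU (X ∪ B)
      obtain ⟨B', p, q, huB, hB', hs', h⟩ := c.exists_bead ⟨v, hv⟩ hBX huc
      exact ⟨(X ∪ B, B'), ⟨⟨u, huB, hu⟩, hB', hs'⟩, rfl, p, q, h⟩)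
  choose hX p q hp hq hpnd hqnd hpq hpav hqav using hstep
  set K : ℕ → Set V := fun n => c.comp (s n).1
  have hKm : Antitone K := antitone_nat_of_succ_le fun n =>
    c.anti _ _ (by rw [hX]; exact Finset.subset_union_left)
  -- the differences `K n \ K (n + 1)`, in which the beads and the paths lie, are disjoint
  have hlevel : ∀ {m n : ℕ} {w : V}, w ∈ K m → w ∉ K (m + 1) → w ∈ K n → w ∉ K (n + 1) →
      m = n := by
    intro m n w h1 h2 h3 h4
    obtain h | h | h := lt_trichotomy m n
    · exact absurd (hKm (Nat.succ_le_of_lt h) h3) h2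
    · exact h
    · exact absurd (hKm (Nat.succ_le_of_lt h) h1) h4
  have hBK : ∀ n, ∀ w ∈ (s n).2, w ∈ K n ∧ w ∉ K (n + 1) := fun n w hw =>
    ⟨(hs n).2.1 hw, fun h => c.notMem_of_mem_comp (by rw [hX]; exact Finset.subset_union_right) h hw⟩
  let inner : ℕ × Bool → List V := fun i => bif i.2 then p i.1 else q i.1
  have hinner : ∀ i, ∀ w ∈ inner i, w ∈ K i.1 ∧ w ∉ (s i.1).2 ∧ w ∉ K (i.1 + 1) := by
    rintro ⟨n, _ | _⟩ w hw
    · exact hqav n w hw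
    · exact hpav n w hw
  refine ⟨⟨fun n => (s n).2, fun n => ?_, fun n => (hs n).2.2, fun m n hmn => ?_, inner,
    hp, hq, ?_, fun i w hw n hwn => ?_, fun i j hij w hi hj => ?_⟩, ?_⟩
  · obtain ⟨u, hu, -⟩ := (hs n).1
    exact ⟨u, hu⟩
  · exact Finset.disjoint_left.2 fun w hm hn =>
      hmn (hlevel (hBK m w hm).1 (hBK m w hm).2 (hBK n w hn).1 (hBK n w hn).2)
  · rintro ⟨n, _ | _⟩
    · exact hqnd n
    · exact hpnd n
  · obtain ⟨h1, h2, h3⟩ := hinner i w hw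
    obtain rfl := hlevel h1 h3 (hBK n w hwn).1 (hBK n w hwn).2
    exact h2 hwn
  · obtain ⟨h1, -, h3⟩ := hinner i w hi
    obtain ⟨h4, -, h6⟩ := hinner j w hj
    obtain ⟨m, x⟩ := i
    obtain ⟨n, y⟩ := j
    obtain rfl : m = n := hlevel h1 h3 h4 h6
    cases x <;> cases y
    · exact hij rfl
    · exact hpq m hj hi
    · exact hpq m hi hj
    · exact hij rfl
  · refine Set.infinite_univ.mono fun n _ => ?_
    exact (hs n).1

open Filter in
theorem IsSolid.exists_necklace (hD : D.IsSolid) {U : Set V} (hU : U.Infinite) :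
    ∃ N : D.Necklace, N.IsAttachedTo U := by
  have := hU.to_subtype
  obtain ⟨c, hc⟩ := hD.exists_direction ((hyperfilter U).map fun u => .inl u.1) (by
    intro v
    have hfin : {u : U | u.1 = v}.Finite :=
      Set.Subsingleton.finite fun a ha b hb => Subtype.ext (Eq.trans ha (Eq.symm hb))
    change ∀ᶠ u : U in (hyperfilter U : Filter U), (Sum.inl u.1 : D.Node) ≠ .inl v
    filter_upwards [hfin.compl_mem_hyperfilter] with u hu h
    exact hu (Sum.inl_injective h))
  refine c.exists_necklace fun X => ?_
  obtain ⟨u, hu⟩ := (show ∀ᶠ u : U in (hyperfilter U : Filter U), u.1 ∈ c.comp X from hc X).exists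
  exact ⟨u, u.2, hu⟩

open Filter in
/-- All but finitely many beads of a necklace lie in the same strong component of `D - X`, for the
beads and the connecting paths far out avoid the finite set `X`. -/
theorem Necklace.exists_isStrongComp (N : D.Necklace) (X : Finset V) :
    ∃ C, D.IsStrongComp (X : Set V)ᶜ C ∧ ∀ᶠ n in atTop, (N.bead n : Set V) ⊆ C := by
  have hbead : ∀ x : V, ∀ᶠ n in atTop, x ∉ N.bead n := by
    intro x
    by_cases hx : ∃ m, x ∈ N.bead m
    · obtain ⟨m, hm⟩ := hx
      filter_upwards [eventually_gt_atTop m] with n hn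
      exact Finset.disjoint_left.1 (N.bead_disjoint m n hn.ne) hm
    · push Not at hx
      exact .of_forall hx
  have hinner : ∀ (d : Bool) (x : V), ∀ᶠ n in atTop, x ∉ N.inner (n, d) := by
    intro d x
    by_cases hx : ∃ m, x ∈ N.inner (m, d)
    · obtain ⟨m, hm⟩ := hx
      filter_upwards [eventually_gt_atTop m] with n hn
      exact fun hn' => N.inner_disjoint (m, d) (n, d) (by simp [hn.ne]) hm hn'
    · push Not at hx
      exact .of_forall hx
  have hev := ((eventually_all_finset X).2 fun x _ => hbead x).and
    (((eventually_all_finset X).2 fun x _ => hinner true x).and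
      ((eventually_all_finset X).2 fun x _ => hinner false x))
  obtain ⟨M, hM⟩ := eventually_atTop.1 hev
  obtain ⟨v, hv⟩ := N.bead_nonempty M
  have hB : ∀ n ≥ M, (N.bead n : Set V) ⊆ (X : Set V)ᶜ := fun n hn w hw hwX =>
    (hM n hn).1 w hwX hw
  have hC := isStrongComp_strongComp (D := D) (hB M le_rfl hv)
  refine ⟨_, hC, eventually_atTop.2 ⟨M, fun n hn => ?_⟩⟩
  induction n, hn using Nat.le_induction with
  | base =>
    exact (N.bead_strong M).subset_isStrongComp (hB M le_rfl) hC hv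
      (mem_strongComp_self (hB M le_rfl hv))
  | succ n hn ih =>
    have hpath : ∀ {a b : V} {l : List V}, List.IsChain D.Adj (a :: (l ++ [b])) →
        (∀ x ∈ X, x ∉ l) → a ∈ (X : Set V)ᶜ → b ∈ (X : Set V)ᶜ → D.ReachIn (X : Set V)ᶜ a b := by
      intro a b l h hl ha hb
      refine reachIn_of_isChain h (fun w hw => ?_) b (by simp)
      simp only [List.mem_cons, List.mem_append, List.not_mem_nil, or_false] at hw
      obtain rfl | hw | rfl := hw
      exacts [ha, fun hwX => hl w hwX hw, hb]
    have hn' : M ≤ n + 1 := hn.trans n.le_succ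
    obtain ⟨a, ha, b, hb, hab⟩ := N.forth n
    obtain ⟨a', ha', b', hb', hab'⟩ := N.back n
    have h1 := hpath hab (hM n hn).2.1 (hB n hn ha) (hB _ hn' hb)
    have h2 := hpath hab' (hM n hn).2.2 (hB _ hn' ha') (hB n hn hb')
    have h3 := (N.bead_strong (n + 1) b hb a' ha').mono (hB _ hn')
    exact (N.bead_strong (n + 1)).subset_isStrongComp (hB _ hn') hC hb
      (hC.mem_of_reach (ih ha) (ih hb') h1 (h3.trans h2))

open Filter in
theorem isSolid_of_forall_exists_necklace
    (h : ∀ U : Set V, U.Infinite → ∃ N : D.Necklace, N.IsAttachedTo U) : D.IsSolid := by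
  by_contra hD
  obtain ⟨X, U, hU, hUC⟩ := exists_infinite_of_not_isSolid hD
  obtain ⟨N, hN⟩ := h U hU
  obtain ⟨C, hC, hev⟩ := N.exists_isStrongComp X
  have hfr : ∃ᶠ n in atTop, ∃ v ∈ N.bead n, v ∈ U := Nat.frequently_atTop_iff_infinite.2 hN
  obtain ⟨m, ⟨v, hv, hvU⟩, hmC⟩ := (hfr.and_eventually hev).exists
  obtain ⟨n, ⟨w, hw, hwU⟩, hnC, hmn⟩ :=
    (hfr.and_eventually (hev.and (eventually_gt_atTop m))).exists
  have hvw : v = w := hUC C hC ⟨hvU, hmC hv⟩ ⟨hwU, hnC hw⟩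
  exact Finset.disjoint_left.1 (N.bead_disjoint m n (ne_of_lt hmn)) hv (hvw ▸ hw)

end Digraph

theorem mainTheorem5 {V : Type u} (D : Digraph V) (hD : ∀ v, ¬ D.Adj v v) :
    List.TFAE [
      CompactSpace D.Space,
      ∀ U : Set V, IsClosed ((Digraph.Space.vertex : V → D.Space) '' U) → U.Finite,
      ∀ U : Set V, U.Infinite → ¬ D.HasRank U,
      ∀ U : Set V, U.Infinite → ∃ N : D.Necklace, N.IsAttachedTo U,
      D.IsSolid] := by
  tfae_have 1 → 2 := fun _ _ hU => Digraph.Space.finite_of_isClosed hU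
  tfae_have 2 → 5 := fun h => by
    by_contra hs
    obtain ⟨X, U, hU, hUC⟩ := Digraph.exists_infinite_of_not_isSolid hs
    exact hU (h U (Digraph.Space.isClosed_of_subsingleton hUC))
  tfae_have 5 → 1 := fun hs => hs.compactSpace hD
  tfae_have 5 → 3 := fun hs _ hU => hs.not_hasRank hU
  tfae_have 3 → 5 := Digraph.isSolid_of_forall_not_hasRank
  tfae_have 5 → 4 := fun hs _ hU => hs.exists_necklace hU
  tfae_have 4 → 5 := Digraph.isSolid_of_forall_exists_necklace
  tfae_finish
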